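/- **Model.** Let $A$ and $B$ be process templates with finite state sets $Q_A,Q_B$ (taken disjoint), initial states ${\sf init}_A,{\sf init}_B$, finite input alphabets $\Sigma_A,\Sigma_B$, and guarded transition relations $\delta_U\subseteq Q_U\times\Sigma_U\times\mathcal P(Q_A\mathbin{\dot\cup}Q_B)\times Q_U$ for $U\in\{A,B\}$. The system $(A,B)^{(1,n)}$ is the interleaving composition of one copy of $A$ and $n$ copies $B_1,\dots,B_n$ of $B$. A local transition $(q,\sigma,g,q')$ of a process $p$ can be taken in a global state $s$ with global input $e$ if $s(p)=q$, $e(p)=\sigma$, and the guard holds conjunctively: $s(p')\in g$ for every process $p'\neq p$; a process is enabled for $(s,e)$ if it has such a transition, and disabled otherwise. The pair $(A,B)$ is *1-conjunctive* if every guard contains ${\sf init}_A$ and ${\sf init}_B$ and has the form $(Q_A\mathbin{\dot\cup}Q_B)\setminus\{q\}$. A run is a sequence of configurations $(s_t,e_t,p_t)$ starting in the global initial state, such that $s_{t+1}$ arises from $s_t$ by one local transition of $p_t$, the input of a process changes only when that process moves, and $p_t=\bot$ if and only if all processes are disabled for $(s_t,e_t)$; a run is infinite or ends in a configuration with $p_t=\bot$.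 A finite run is *globally deadlocked*. An infinite run is *locally deadlocked* if some process is disabled at all moments from some moment on; *strong-fair* if every process that is enabled infinitely often moves infinitely often; *initializing* if every process that moves infinitely often visits its initial state infinitely often. Say that $(A,B)^{(1,n)}$ has a *global deadlock* if it has a finite run, a *local deadlock* if it has a strong-fair initializing locally deadlocked run, and a *deadlock* if it has a global or a local deadlock. **Theorem.** Let $(A,B)$ be 1-conjunctive and let $m=|Q_B\setminus\{{\sf init}_B\}|$. 1. (Bounding, global deadlocks.) For every $n>2m$: if $(A,B)^{(1,n)}$ has a global deadlock, then so does $(A,B)^{(1,2m)}$. 2. (Bounding, local deadlocks.) If $|Q_B|>2$, then for every $n>2m+1$: if $(A,B)^{(1,n)}$ has a local deadlock, then so does $(A,B)^{(1,2m+1)}$. 3. (Bounding, deadlocks.) If $|Q_B|>2$, then for every $n>2m$: if $(A,B)^{(1,n)}$ has a deadlock, then so does $(A,B)^{(1,2m)}$. 4. (Monotonicity.) For every $n\ge 1$ such that all infinite strong-fair runs of $(A,B)^{(1,n+1)}$ are initializing: if $(A,B)^{(1,n)}$ has a deadlock, then so does $(A,B)^{(1,n+1)}$. 5. (Cutoff.)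 If $|Q_B|>2$ and, for every $n\ge1$, all infinite strong-fair runs of $(A,B)^{(1,n)}$ are initializing, then $c=2|Q_B|-2$ is a cutoff for deadlock detection: for every $n\ge c$, $(A,B)^{(1,n)}$ has a deadlock if and only if $(A,B)^{(1,c)}$ has a deadlock. -/

import Mathlib

open Filter

namespace GuardedProtocol

/-- A process template with state set `Q` and input alphabet `I`.  Its guards are subsets of the
disjoint union `QA ⊕ QB` of the state sets of the two templates of the protocol.  A closed template
is one with a one-letter alphabet. -/
structure ProcessTemplate (QA QB Q I : Type*) where
  /-- the initial state -/
  init : Q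
  /-- the guarded transition relation, a set of tuples (source, input, guard, target) -/
  trans : Set (Q × I × Set (QA ⊕ QB) × Q)

/-- The processes of the system with one copy of `A` and `n` copies of `B`. -/
inductive Proc (n : ℕ) : Type
  | A : Proc n
  | B (i : Fin n) : Proc n

/-- Global states, and (with alphabets in place of state sets) global inputs. -/
abbrev Global (X Y : Type*) (n : ℕ) := X × (Fin n → Y)

/-- The component of a global state or a global input at a process. -/
def Global.at {X Y : Type*} {n : ℕ} (s : Global X Y n) : Proc n → X ⊕ Y
  | .A => Sum.inl s.1
  | .B i => Sum.inr (s.2 i)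

/-- Conjunctive guards: the local states of all processes other than `p` lie in `g`. -/
def GuardSat {QA QB : Type*} {n : ℕ} (s : Global QA QB n) (p : Proc n)
    (g : Set (QA ⊕ QB)) : Prop :=
  ∀ p' : Proc n, p' ≠ p → s.at p' ∈ g

/-- A configuration: a global state, a global input, and the process that moves (or `⊥`). -/
structure Config (QA QB IA IB : Type*) (n : ℕ) where
  state : Global QA QB n
  input : Global IA IB n
  mover : WithBot (Proc n)

section System

variable {QA QB IA IB : Type*} (A : ProcessTemplate QA QB QA IA) (B : ProcessTemplate QA QB QB IB)

/-- Every guard contains both initial states (the standing assumption on conjunctive systems), and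
every guard is the set of all local states except one. -/
def IsOneConjunctive : Prop :=
  (∀ q σ g q', (q, σ, g, q') ∈ A.trans →
    Sum.inl A.init ∈ g ∧ Sum.inr B.init ∈ g ∧ ∃ r : QA ⊕ QB, g = {r}ᶜ) ∧
  (∀ q σ g q', (q, σ, g, q') ∈ B.trans →
    Sum.inl A.init ∈ g ∧ Sum.inr B.init ∈ g ∧ ∃ r : QA ⊕ QB, g = {r}ᶜ)

variable {n : ℕ}

/-- `s'` arises from `s` under the input `e` by one local transition of the process `p` whose guard
is satisfied for `p` in `s`. -/
def Step (s : Global QA QB n) (e : Global IA IB n) (p : Proc n) (s' : Global QA QB n) : Prop :=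
  match p with
  | .A => ∃ g q', (s.1, e.1, g, q') ∈ A.trans ∧ GuardSat s .A g ∧ s' = (q', s.2)
  | .B i => ∃ g q', (s.2 i, e.2 i, g, q') ∈ B.trans ∧ GuardSat s (.B i) g ∧
      s' = (s.1, Function.update s.2 i q')

/-- The process `p` is enabled for `s` and `e`. -/
def Enabled (s : Global QA QB n) (e : Global IA IB n) (p : Proc n) : Prop :=
  ∃ s', Step A B s e p s'

/-- The local state `q` is the initial state of the template it belongs to. -/
def IsInitial : QA ⊕ QB → Prop
  | .inl q => q = A.init
  | .inr q => q = B.init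

/-- The first `len` entries of `x` (all entries, if `len = ⊤`) form a path. -/
def IsPath (len : ℕ∞) (x : ℕ → Config QA QB IA IB n) : Prop :=
  (∀ t : ℕ, ((t + 1 : ℕ) : ℕ∞) < len →
    (∃ p : Proc n, (x t).mover = (p : WithBot (Proc n)) ∧
      Step A B (x t).state (x t).input p (x (t + 1)).state) ∧
    ∀ p : Proc n, (x (t + 1)).input.at p = (x t).input.at p ∨
      (x t).mover = (p : WithBot (Proc n))) ∧
  ∀ t : ℕ, (t : ℕ∞) < len →
    ((x t).mover = ⊥ ↔ ∀ p : Proc n, ¬ Enabled A B (x t).state (x t).input p)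

/-- The first `len` entries of `x` (all entries, if `len = ⊤`) form a run: a path that starts in the
global initial state and is infinite or ends in a configuration whose mover is `⊥`. -/
def IsRun (len : ℕ∞) (x : ℕ → Config QA QB IA IB n) : Prop :=
  IsPath A B len x ∧ 0 < len ∧ (x 0).state = (A.init, fun _ => B.init) ∧
    ∀ t : ℕ, ((t + 1 : ℕ) : ℕ∞) = len → (x t).mover = ⊥

/-- The process `p` moves infinitely often in the infinite run `x`. -/
def MovesInfinitelyOften (x : ℕ → Config QA QB IA IB n) (p : Proc n) : Prop :=
  ∃ᶠ t in atTop, (x t).mover = (p : WithBot (Proc n))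

/-- Strong fairness of an infinite run. -/
def IsStrongFair (x : ℕ → Config QA QB IA IB n) : Prop :=
  ∀ p : Proc n, (∃ᶠ t in atTop, Enabled A B (x t).state (x t).input p) → MovesInfinitelyOften x p

/-- An infinite run is initializing if every process that moves infinitely often visits its initial
state infinitely often. -/
def IsInitializing (x : ℕ → Config QA QB IA IB n) : Prop :=
  ∀ p : Proc n, MovesInfinitelyOften x p → ∃ᶠ t in atTop, IsInitial A B ((x t).state.at p)

/-- The infinite run `x` is locally deadlocked for `p`. -/
def IsLocallyDeadlockedFor (x : ℕ → Config QA QB IA IB n) (p : Proc n) : Prop :=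
  ∃ t : ℕ, ∀ t' ≥ t, ¬ Enabled A B (x t').state (x t').input p

variable (n)

/-- The system with `n` copies of `B` has a global deadlock: a finite run. -/
def HasGlobalDeadlock : Prop :=
  ∃ (len : ℕ∞) (x : ℕ → Config QA QB IA IB n), IsRun A B len x ∧ len ≠ ⊤

/-- The system with `n` copies of `B` has a local deadlock on strong-fair initializing runs. -/
def HasFairLocalDeadlock : Prop :=
  ∃ x : ℕ → Config QA QB IA IB n, IsRun A B ⊤ x ∧ IsStrongFair A B x ∧ IsInitializing A B x ∧
    ∃ p : Proc n, IsLocallyDeadlockedFor A B x p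

/-- The system with `n` copies of `B` has a deadlock on strong-fair initializing or finite runs. -/
def HasFairDeadlock : Prop :=
  HasGlobalDeadlock A B n ∨ HasFairLocalDeadlock A B n

/-- Every infinite strong-fair run of the system with `n` copies of `B` is initializing. -/
def FairRunsInitializing : Prop :=
  ∀ x : ℕ → Config QA QB IA IB n, IsRun A B ⊤ x → IsStrongFair A B x → IsInitializing A B x

/-- `c` is a cutoff for deadlock detection on strong-fair initializing or finite runs. -/
def IsFairDeadlockCutoff (c : ℕ) : Prop :=
  ∀ n ≥ c, (HasFairDeadlock A B n ↔ HasFairDeadlock A B c)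

end System

end GuardedProtocol

namespace GuardedProtocol

/-! ### Global states and processes -/

section Basics

/-! A guard `{r}ᶜ` fails for a process exactly when some other process occupies `r`, and `r` is
never an initial state. So whether a process is disabled depends only on its own state and input and
on which non-initial states other processes occupy. To keep a set of processes disabled it suffices
to keep two occupants of each non-initial state that has several: the second one is needed when the
blocked process itself sits in `r`. Removing processes, or parking them in the initial state, only
makes guards easier to satisfy, so reachability survives (`Reachable.pullState`). Two copies for
each of the `m` non-initial states give the bound `2m` for global deadlocks.

For a local deadlock, fairness and finiteness split the processes into a set `D` that is eventually
stuck and the others, which return to their initial states for ever. A state blocking a member of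
`D` is held by a member of `D`, or lies in the set `R` of states that moving copies of `B` keep
occupied (`HasFairLocalDeadlock.exists_isStuckConfig`). In the smaller system, states of `D` keep up
to two occupants and each state of `R` one. A process leaves a state of `R` only after a fresh copy
has entered it from the initial state. All this happens one process at a time on a closed walk,
which is then repeated for ever (`hasFairLocalDeadlock_of_lasso`).

The counting fits because a state of `R` costs one copy instead of two, which leaves room for the
fresh copy among `2m`. If only the initial state of `B` is stuck, at most `m` copies are selected
and two fresh ones are added, which needs `m ≥ 2`. If the selected copies fill all `2m` places and
everything is stuck, the deadlock has become global; this is why local deadlocks alone need `2m +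
1`.

For monotonicity, the same construction adds a copy when some copy of `B` moves. Otherwise the stuck
processes block each other, and any fair continuation of the enlarged system is a deadlock
(`hasFairDeadlock_of_blocked`). -/

theorem Global.ext_at {X Y : Type*} {n : ℕ} {s s' : Global X Y n}
    (h : ∀ p, s.at p = s'.at p) : s = s' := by
  refine Prod.ext ?_ (funext fun i => ?_)
  · simpa [Global.at] using h .A
  · simpa [Global.at] using h (.B i)

/-- A global state can be changed at one process. -/
theorem Global.exists_update {X Y : Type*} {n : ℕ} (s : Global X Y n) (p : Proc n) (v : X ⊕ Y)
    (hv : v.isLeft = (s.at p).isLeft) :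
    ∃ s' : Global X Y n, s'.at p = v ∧ ∀ p' ≠ p, s'.at p' = s.at p' := by
  cases p with
  | A =>
    rcases v with a | b
    · refine ⟨(a, s.2), rfl, fun p' hp' => ?_⟩
      cases p' with
      | A => exact absurd rfl hp'
      | B i => rfl
    · simp [Global.at] at hv
  | B i =>
    rcases v with a | b
    · simp [Global.at] at hv
    · refine ⟨(s.1, Function.update s.2 i b), by simp [Global.at], fun p' hp' => ?_⟩
      cases p' with
      | A => rfl
      | B j =>
        have : j ≠ i := fun h => hp' (by rw [h])
        simp [Global.at, this]

theorem Global.exists_of_forall {X Y : Type*} {n : ℕ} {P : Proc n → X ⊕ Y → Prop}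
    (hA : ∃ x, P .A (.inl x)) (hB : ∀ i, ∃ y, P (.B i) (.inr y)) :
    ∃ e : Global X Y n, ∀ p, P p (e.at p) := by
  obtain ⟨x, hx⟩ := hA
  choose y hy using hB
  refine ⟨(x, y), fun p => ?_⟩
  cases p with
  | A => exact hx
  | B i => exact hy i

theorem Global.isLeft_at {X Y X' Y' : Type*} {n : ℕ} (s : Global X Y n) (e : Global X' Y' n)
    (p : Proc n) : (s.at p).isLeft = (e.at p).isLeft := by
  cases p <;> rfl

instance Proc.instFinite (n : ℕ) : Finite (Proc n) :=
  Finite.of_surjective (fun o : Option (Fin n) => o.elim Proc.A Proc.B) fun p => by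
    cases p with
    | A => exact ⟨none, rfl⟩
    | B i => exact ⟨some i, rfl⟩

end Basics

/-! ### Local transitions, reachability, and removal of copies -/

section Semantics

variable {QA QB IA IB : Type*} (A : ProcessTemplate QA QB QA IA) (B : ProcessTemplate QA QB QB IB)
  {n N : ℕ}

/-- The transitions of both templates, as one relation on the disjoint unions. -/
def LocalTrans : QA ⊕ QB → IA ⊕ IB → Set (QA ⊕ QB) → QA ⊕ QB → Prop
  | .inl q, .inl σ, g, .inl q' => (q, σ, g, q') ∈ A.trans
  | .inr q, .inr σ, g, .inr q' => (q, σ, g, q') ∈ B.trans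
  | _, _, _, _ => False

variable {A B}

theorem LocalTrans.isLeft_eq {u u' : QA ⊕ QB} {v : IA ⊕ IB} {g : Set (QA ⊕ QB)}
    (h : LocalTrans A B u v g u') : u'.isLeft = u.isLeft ∧ v.isLeft = u.isLeft := by
  rcases u with _ | _ <;> rcases v with _ | _ <;> rcases u' with _ | _ <;>
    simp_all [LocalTrans]

/-- Both initial states lie in every guard, so a process in its initial state blocks nobody. -/
theorem LocalTrans.guard (hAB : IsOneConjunctive A B) {u u' : QA ⊕ QB} {v : IA ⊕ IB}
    {g : Set (QA ⊕ QB)} (h : LocalTrans A B u v g u') :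
    ∃ r, ¬ IsInitial A B r ∧ g = {r}ᶜ := by
  have key : Sum.inl A.init ∈ g ∧ Sum.inr B.init ∈ g ∧ ∃ r : QA ⊕ QB, g = {r}ᶜ := by
    rcases u with _ | _ <;> rcases v with _ | _ <;> rcases u' with _ | _ <;>
      simp only [LocalTrans] at h
    · exact hAB.1 _ _ _ _ h
    · exact hAB.2 _ _ _ _ h
  obtain ⟨h1, h2, r, rfl⟩ := key
  refine ⟨r, fun hr => ?_, rfl⟩
  rcases r with r | r
  · exact h1 (congrArg Sum.inl (Eq.symm hr))
  · exact h2 (congrArg Sum.inr (Eq.symm hr))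

theorem step_iff {s s' : Global QA QB n} {e : Global IA IB n} {p : Proc n} :
    Step A B s e p s' ↔ ∃ g, LocalTrans A B (s.at p) (e.at p) g (s'.at p) ∧ GuardSat s p g ∧
      ∀ p' ≠ p, s'.at p' = s.at p' := by
  cases p with
  | A =>
    constructor
    · rintro ⟨g, q', h, hg, rfl⟩
      refine ⟨g, h, hg, fun p' hp' => ?_⟩
      cases p' with
      | A => exact absurd rfl hp'
      | B i => rfl
    · rintro ⟨g, h, hg, hs⟩
      refine ⟨g, s'.1, h, hg, Global.ext_at fun p => ?_⟩
      cases p with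
      | A => rfl
      | B i => exact hs (.B i) (by simp)
  | B i =>
    constructor
    · rintro ⟨g, q', h, hg, rfl⟩
      refine ⟨g, by simpa [LocalTrans, Global.at] using h, hg, fun p' hp' => ?_⟩
      cases p' with
      | A => rfl
      | B j =>
        have : j ≠ i := fun h => hp' (by rw [h])
        simp [Global.at, this]
    · rintro ⟨g, h, hg, hs⟩
      refine ⟨g, s'.2 i, h, hg, Global.ext_at fun p => ?_⟩
      by_cases hp : p = .B i
      · subst hp
        simp [Global.at]
      · rw [hs p hp]
        cases p with
        | A => rfl
        | B j =>
          have : j ≠ i := fun h => hp (by rw [h])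
          simp [Global.at, this]

theorem enabled_iff {s : Global QA QB n} {e : Global IA IB n} {p : Proc n} :
    Enabled A B s e p ↔ ∃ g u, LocalTrans A B (s.at p) (e.at p) g u ∧ GuardSat s p g := by
  constructor
  · rintro ⟨s', h⟩
    obtain ⟨g, h1, h2, -⟩ := step_iff.1 h
    exact ⟨g, _, h1, h2⟩
  · rintro ⟨g, u, h1, h2⟩
    obtain ⟨s', h3, h4⟩ := s.exists_update p u h1.isLeft_eq.1
    exact ⟨s', step_iff.2 ⟨g, h3 ▸ h1, h2, h4⟩⟩

theorem guardSat_compl {s : Global QA QB n} {p : Proc n} {r : QA ⊕ QB} :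
    GuardSat s p {r}ᶜ ↔ ∀ p' ≠ p, s.at p' ≠ r := Iff.rfl

theorem not_enabled_iff (hAB : IsOneConjunctive A B) {s : Global QA QB n} {e : Global IA IB n}
    {p : Proc n} : ¬ Enabled A B s e p ↔
      ∀ r u, LocalTrans A B (s.at p) (e.at p) {r}ᶜ u → ∃ p' ≠ p, s.at p' = r := by
  rw [enabled_iff]
  constructor
  · intro h r u hu
    by_contra! hc
    exact h ⟨_, u, hu, guardSat_compl.2 hc⟩
  · rintro h ⟨g, u, hu, hg⟩
    obtain ⟨r, -, rfl⟩ := hu.guard hAB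
    obtain ⟨p', hp', hr⟩ := h r u hu
    exact hg p' hp' hr

variable (A B)

/-- The initial local state of a process. -/
def initAt : Proc n → QA ⊕ QB := Global.at (A.init, fun _ => B.init)

theorem isInitial_at_iff {s : Global QA QB n} {p : Proc n} :
    IsInitial A B (s.at p) ↔ s.at p = initAt A B p := by
  cases p <;> simp [IsInitial, initAt, Global.at]

theorem isInitial_initAt (p : Proc n) : IsInitial A B (initAt A B p) := by
  cases p <;> simp [IsInitial, initAt, Global.at]

/-- The global states that are reachable, for some choice of the inputs. -/
inductive Reachable : Global QA QB n → Prop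
  | init : Reachable (A.init, fun _ => B.init)
  | step {s s' : Global QA QB n} {e : Global IA IB n} {p : Proc n} :
      Reachable s → Step A B s e p s' → Reachable s'

/-- The process `p` moves from one pair of a global state and a global input to another. -/
def Move (p : Proc n) (c c' : Global QA QB n × Global IA IB n) : Prop :=
  Step A B c.1 c.2 p c'.1 ∧ ∀ p' ≠ p, c'.2.at p' = c.2.at p'

variable {A B}

theorem Move.enabled {p : Proc n} {c c' : Global QA QB n × Global IA IB n}
    (h : Move A B p c c') : Enabled A B c.1 c.2 p := ⟨_, h.1⟩

theorem Step.congr_input {s s' : Global QA QB n} {e e' : Global IA IB n} {p : Proc n}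
    (h : Step A B s e p s') (he : e'.at p = e.at p) : Step A B s e' p s' := by
  rw [step_iff] at h ⊢
  rwa [he]

/-- A reachable state is reached by a finite path with any prescribed last input. -/
theorem Reachable.exists_path {s : Global QA QB n} (hs : Reachable A B s) :
    ∀ e : Global IA IB n, ∃ (k : ℕ) (w : ℕ → Global QA QB n × Global IA IB n) (m : ℕ → Proc n),
      (w 0).1 = (A.init, fun _ => B.init) ∧ (∀ t < k, Move A B (m t) (w t) (w (t + 1))) ∧
      w k = (s, e) := by
  induction hs with
  | init => exact fun e => ⟨0, fun _ => (_, e), fun _ => .A, rfl, by simp, rfl⟩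
  | @step s s' e₀ p _ hstep ih =>
    intro e
    -- The mover needs the input of this step and may choose its final input afterwards; all other
    -- processes must already carry theirs.
    obtain ⟨e₁, h₁, h₂⟩ := e.exists_update p (e₀.at p) (e₀.isLeft_at e p)
    obtain ⟨k, w, m, hw0, hw, hwk⟩ := ih e₁
    refine ⟨k + 1, fun t => if t ≤ k then w t else (s', e), fun t => if t < k then m t else p,
      by simpa using hw0, fun t ht => ?_, by simp⟩
    rcases Nat.lt_succ_iff_lt_or_eq.1 ht with ht' | rfl
    · simpa [ht'.le, Nat.succ_le_of_lt ht', ht'] using hw t ht'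
    · simpa [hwk, Move] using ⟨hstep.congr_input h₁, fun p' hp' => (h₂ p' hp').symm⟩

/-- An infinite sequence of moves from a reachable state is a tail of a run. -/
theorem Reachable.exists_isRun {y : ℕ → Global QA QB n × Global IA IB n} {m : ℕ → Proc n}
    (hs : Reachable A B (y 0).1) (hy : ∀ t, Move A B (m t) (y t) (y (t + 1))) :
    ∃ x : ℕ → Config QA QB IA IB n, IsRun A B ⊤ x ∧
      ∃ k, ∀ t, x (t + k) = ⟨(y t).1, (y t).2, (m t : WithBot (Proc n))⟩ := by
  obtain ⟨k, w, m', hw0, hw, hwk⟩ := hs.exists_path (y 0).2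
  set v : ℕ → Global QA QB n × Global IA IB n := fun t => if t < k then w t else y (t - k)
  set l : ℕ → Proc n := fun t => if t < k then m' t else m (t - k)
  have hv : ∀ t, Move A B (l t) (v t) (v (t + 1)) := by
    intro t
    rcases lt_trichotomy (t + 1) k with h | h | h
    · simpa [v, l, h, (Nat.lt_succ_self t).trans h] using hw t (by omega)
    · have := hw t (by omega)
      subst h
      rw [hwk] at this
      simpa [v, l] using this
    · have h1 : ¬ t < k := by omega
      have h2 : ¬ t + 1 < k := by omega
      have h3 : t + 1 - k = t - k + 1 := by omega
      simpa [v, l, h1, h2, h3] using hy (t - k)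
  have hv0 : (v 0).1 = (A.init, fun _ => B.init) := by
    rcases Nat.eq_zero_or_pos k with rfl | h
    · simp only [v, lt_irrefl, if_false]
      rw [← hw0, hwk]
    · simpa [v, h] using hw0
  refine ⟨fun t => ⟨(v t).1, (v t).2, l t⟩, ⟨⟨fun t _ => ⟨⟨l t, rfl, (hv t).1⟩, fun p => ?_⟩,
    fun t _ => ?_⟩, by simp, hv0, fun t ht => absurd ht (ENat.natCast_ne_top _)⟩, k,
    fun t => by simp [v, l]⟩
  · by_cases hp : p = l t
    · exact Or.inr (by rw [hp])
    · exact Or.inl ((hv t).2 p hp)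
  · exact ⟨fun h => absurd h (WithBot.coe_ne_bot), fun h => absurd (hv t).enabled (h _)⟩

theorem IsRun.reachable {len : ℕ∞} {x : ℕ → Config QA QB IA IB n} (hx : IsRun A B len x) :
    ∀ t : ℕ, (t : ℕ∞) < len → Reachable A B (x t).state := by
  intro t
  induction t with
  | zero => intro _; rw [hx.2.2.1]; exact .init
  | succ t ih =>
    intro ht
    obtain ⟨⟨p, -, hp⟩, -⟩ := hx.1.1 t ht
    exact (ih (lt_of_le_of_lt (by exact_mod_cast Nat.le_succ t) ht)).step hp

theorem hasGlobalDeadlock_iff : HasGlobalDeadlock A B n ↔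
    ∃ (s : Global QA QB n) (e : Global IA IB n), Reachable A B s ∧ ∀ p, ¬ Enabled A B s e p := by
  constructor
  · rintro ⟨len, x, hx, hlen⟩
    lift len to ℕ using hlen
    have h0 : 0 < len := by exact_mod_cast hx.2.1
    obtain ⟨k, rfl⟩ : ∃ k, len = k + 1 := ⟨len - 1, by omega⟩
    have hk : (k : ℕ∞) < ((k + 1 : ℕ) : ℕ∞) := by exact_mod_cast Nat.lt_succ_self k
    exact ⟨_, _, hx.reachable k hk, (hx.1.2 k hk).1 (hx.2.2.2 k rfl)⟩
  · rintro ⟨s, e, hs, hdis⟩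
    obtain ⟨k, w, m, hw0, hw, hwk⟩ := hs.exists_path e
    refine ⟨((k + 1 : ℕ) : ℕ∞), fun t => ⟨(w t).1, (w t).2, if t < k then m t else ⊥⟩,
      ⟨⟨fun t ht => ?_, fun t ht => ?_⟩, by simp, hw0, fun t ht => ?_⟩, ENat.natCast_ne_top _⟩
    · have ht' : t < k := by
        have : t + 1 < k + 1 := by exact_mod_cast ht
        omega
      refine ⟨⟨m t, by simp [ht'], (hw t ht').1⟩, fun p => ?_⟩
      by_cases hp : p = m t
      · exact Or.inr (by simp [hp, ht'])
      · exact Or.inl ((hw t ht').2 p hp)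
    · have ht' : t < k + 1 := by exact_mod_cast ht
      rcases Nat.lt_succ_iff_lt_or_eq.1 ht' with h | rfl
      · simp only [h, if_true]
        exact ⟨fun h' => absurd h' (WithBot.coe_ne_bot), fun h' => absurd (hw t h).enabled (h' _)⟩
      · simpa [hwk] using hdis
    · have : t + 1 = k + 1 := by exact_mod_cast ht
      obtain rfl : t = k := by omega
      simp

/-- The state of the system with `N` copies in which the copy `i` is in the state of the copy
`g i` of the system with `n` copies, or in the initial state. -/
def pullState (B : ProcessTemplate QA QB QB IB) (g : Fin N → Option (Fin n))
    (s : Global QA QB n) : Global QA QB N :=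
  (s.1, fun i => (g i).elim B.init s.2)

/-- Moves of kept copies remain possible, since fewer processes can violate the guard and copies
parked in the initial state never do; moves of dropped copies are skipped. The argument `e₀` only
supplies inputs for the processes that do not move. -/
theorem Reachable.pullState (hAB : IsOneConjunctive A B) {s : Global QA QB n}
    (hs : Reachable A B s) {g : Fin N → Option (Fin n)}
    (hg : ∀ i j b, g i = some b → g j = some b → i = j) (e₀ : Global IA IB N) :
    Reachable A B (pullState B g s) := by
  induction hs with
  | init =>
    have : GuardedProtocol.pullState B g (A.init, fun _ => B.init) = (A.init, fun _ => B.init) := by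
      refine Prod.ext rfl (funext fun i => ?_)
      simp only [GuardedProtocol.pullState]
      cases g i <;> rfl
    rw [this]
    exact .init
  | @step s s' e p _ hstep ih =>
    obtain ⟨gd, htr, hsat, hoff⟩ := step_iff.1 hstep
    obtain ⟨r, hr, rfl⟩ := htr.guard hAB
    have hB : ∀ (s : Global QA QB n) i b, g i = some b →
        (GuardedProtocol.pullState B g s).at (.B i) = s.at (.B b) :=
      fun s i hi => by simp +contextual [GuardedProtocol.pullState, Global.at]
    have key : ∀ p₀ : Proc N,
        (GuardedProtocol.pullState B g s).at p₀ = s.at p →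
        (GuardedProtocol.pullState B g s').at p₀ = s'.at p →
        (∀ p' ≠ p₀, (∃ p'' ≠ p, (GuardedProtocol.pullState B g s).at p' = s.at p'' ∧
            (GuardedProtocol.pullState B g s').at p' = s'.at p'') ∨
          ((GuardedProtocol.pullState B g s).at p' = .inr B.init ∧
            (GuardedProtocol.pullState B g s').at p' = .inr B.init)) →
        Reachable A B (GuardedProtocol.pullState B g s') := by
      intro p₀ h₁ h₁' h₂
      obtain ⟨e₁, he₁, -⟩ := e₀.exists_update p₀ (e.at p) (by
        rw [← s.isLeft_at e, ← h₁]; exact Global.isLeft_at _ _ _)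
      refine ih.step (e := e₁) (p := p₀) (step_iff.2 ⟨{r}ᶜ, ?_, ?_, ?_⟩)
      · rwa [h₁, h₁', he₁]
      · intro p' hp'
        rcases h₂ p' hp' with ⟨p'', h, h', -⟩ | ⟨h, -⟩
        · rw [h']; exact hsat p'' h
        · rw [h]
          rintro rfl
          exact hr rfl
      · intro p' hp'
        rcases h₂ p' hp' with ⟨p'', h, h', h''⟩ | ⟨h, h'⟩
        · rw [h', h'', hoff p'' h]
        · rw [h, h']
    have other : ∀ i, g i = none → ((GuardedProtocol.pullState B g s).at (.B i) = .inr B.init ∧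
            (GuardedProtocol.pullState B g s').at (.B i) = .inr B.init) := fun i hi => by
      simp [GuardedProtocol.pullState, Global.at, hi]
    cases p with
    | A =>
      refine key .A rfl rfl fun p' hp' => ?_
      cases p' with
      | A => exact absurd rfl hp'
      | B i =>
        rcases hi : g i with _ | b
        · exact Or.inr (other i hi)
        · exact Or.inl ⟨.B b, by simp, hB s i b hi, hB s' i b hi⟩
    | B b =>
      by_cases hb : ∃ i, g i = some b
      · obtain ⟨i, hi⟩ := hb
        refine key (.B i) (hB s i b hi) (hB s' i b hi) fun p' hp' => ?_
        cases p' with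
        | A => exact Or.inl ⟨.A, by simp, rfl, rfl⟩
        | B j =>
          rcases hj : g j with _ | b'
          · exact Or.inr (other j hj)
          · refine Or.inl ⟨.B b', ?_, hB s j b' hj, hB s' j b' hj⟩
            rintro h
            obtain rfl : b' = b := by simpa using h
            exact hp' (by rw [hg i j b' hi hj])
      · have : GuardedProtocol.pullState B g s' = GuardedProtocol.pullState B g s := by
          refine Global.ext_at fun p' => ?_
          cases p' with
          | A => exact hoff .A (by simp)
          | B j =>
            rcases hj : g j with _ | b'
            · rw [(other j hj).1, (other j hj).2]
            · rw [hB s j b' hj, hB s' j b' hj]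
              refine hoff _ fun h => hb ⟨j, ?_⟩
              obtain rfl : b' = b := by simpa using h
              exact hj
        rw [this]
        exact ih

end Semantics

/-! ### Fair scheduling -/

section Schedules

variable {QA QB IA IB : Type*} {A : ProcessTemplate QA QB QA IA} {B : ProcessTemplate QA QB QB IB}
  {n N : ℕ}

theorem exists_isRun_of_moves_of_disabled {y : ℕ → Global QA QB n × Global IA IB n}
    {m : ℕ → Proc n} (hs : Reachable A B (y 0).1)
    (hy : ∀ t, Move A B (m t) (y t) (y (t + 1))) {p₀ : Proc n}
    (hp₀ : ∀ t, ¬ Enabled A B (y t).1 (y t).2 p₀)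
    (hfair : ∀ p, (∃ᶠ t in atTop, Enabled A B (y t).1 (y t).2 p) → ∃ᶠ t in atTop, m t = p) :
    ∃ x : ℕ → Config QA QB IA IB n, IsRun A B ⊤ x ∧ IsStrongFair A B x ∧
      IsLocallyDeadlockedFor A B x p₀ ∧
      ∃ k, ∀ t, x (t + k) = ⟨(y t).1, (y t).2, (m t : WithBot (Proc n))⟩ := by
  obtain ⟨x, hx, k, hk⟩ := hs.exists_isRun hy
  have hshift : ∀ P : Config QA QB IA IB n → Prop, (∃ᶠ t in atTop, P (x t)) ↔
      ∃ᶠ t in atTop, P ⟨(y t).1, (y t).2, (m t : WithBot (Proc n))⟩ := by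
    intro P
    have := (frequently_map (m := fun t => t + k) (f := atTop) (P := fun t => P (x t)))
    rw [map_add_atTop_eq_nat] at this
    simpa only [hk] using this
  refine ⟨x, hx, fun p hp => ?_, ⟨k, fun t ht => ?_⟩, k, hk⟩
  · rw [hshift fun c => Enabled A B c.state c.input p] at hp
    refine (hshift fun c => c.mover = (p : WithBot (Proc n))).2 ((hfair p hp).mono ?_)
    rintro t rfl
    rfl
  · obtain ⟨j, rfl⟩ := Nat.exists_eq_add_of_le' ht
    rw [hk]
    exact hp₀ j

/-- Scheduling the enabled processes with the fewest moves is strong-fair. -/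
theorem frequently_of_minimal_count {P : Type*} [Finite P] {m : ℕ → P} {cnt : ℕ → P → ℕ}
    {en : ℕ → P → Prop} (hself : ∀ t, cnt (t + 1) (m t) = cnt t (m t) + 1)
    (hother : ∀ t p, p ≠ m t → cnt (t + 1) p = cnt t p)
    (hmin : ∀ t p, en t p → cnt t (m t) ≤ cnt t p) {p : P} (hp : ∃ᶠ t in atTop, en t p) :
    ∃ᶠ t in atTop, m t = p := by
  have hmono : ∀ q, Monotone fun t => cnt t q := fun q => monotone_nat_of_le_succ fun t => by
    by_cases h : q = m t
    · subst h; rw [hself]; exact Nat.le_succ _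
    · exact (hother t q h).ge
  intro hnot
  obtain ⟨T, hT⟩ := eventually_atTop.1 hnot
  have hconst : ∀ t ≥ T, cnt t p = cnt T p := by
    intro t ht
    induction t, ht using Nat.le_induction with
    | base => rfl
    | succ t ht ih => rw [hother t p fun h => hT t ht h.symm, ih]
  -- If `p` starves, its count is frozen, so infinitely often the scheduled process has a count
  -- below a fixed bound. By finiteness one process `q` does so infinitely often, yet each such move
  -- increases its count.
  have hsmall : ∃ᶠ t in atTop, ∃ q, m t = q ∧ cnt t q ≤ cnt T p :=
    (hp.and_eventually (eventually_ge_atTop T)).mono fun t ht =>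
      ⟨m t, rfl, (hmin t p ht.1).trans (hconst t ht.2).le⟩
  obtain ⟨q, hq⟩ : ∃ q, ∃ᶠ t in atTop, m t = q ∧ cnt t q ≤ cnt T p := by
    by_contra! h
    refine hsmall ?_
    filter_upwards [eventually_all.2 h] with t ht
    rintro ⟨q, hq, hle⟩
    exact absurd (ht q hq) hle.not_gt
  have hgrow : ∀ k, ∃ t, k ≤ cnt t q := by
    intro k
    induction k with
    | zero => exact ⟨0, Nat.zero_le _⟩
    | succ k ih =>
      obtain ⟨t, ht⟩ := ih
      obtain ⟨t', htt', rfl, -⟩ := frequently_atTop.1 hq t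
      exact ⟨t' + 1, by rw [hself]; exact Nat.succ_le_succ (ht.trans (hmono _ htt'))⟩
  obtain ⟨t, ht⟩ := hgrow (cnt T p + 1)
  obtain ⟨t', htt', -, h⟩ := frequently_atTop.1 hq t
  exact absurd (ht.trans (hmono q htt')) (by simpa using h)

/-- A reachable set of processes that block each other yields a deadlock. -/
theorem hasFairDeadlock_of_blocked (hAB : IsOneConjunctive A B)
    (hinit : FairRunsInitializing A B n) {s : Global QA QB n} {e : Global IA IB n}
    (hs : Reachable A B s) {K : Set (Proc n)} (hK : K.Nonempty)
    (hblock : ∀ p ∈ K, ∀ r u, LocalTrans A B (s.at p) (e.at p) {r}ᶜ u →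
      ∃ p' ∈ K, p' ≠ p ∧ s.at p' = r) :
    HasFairDeadlock A B n := by
  let Inv : Global QA QB n × Global IA IB n → Prop := fun c =>
    Reachable A B c.1 ∧ ∀ p ∈ K, c.1.at p = s.at p ∧ c.2.at p = e.at p
  have hdis : ∀ c, Inv c → ∀ p ∈ K, ¬ Enabled A B c.1 c.2 p := by
    intro c hc p hp
    rw [not_enabled_iff hAB]
    intro r u hu
    rw [(hc.2 p hp).1, (hc.2 p hp).2] at hu
    obtain ⟨p', hp', hne, hr⟩ := hblock p hp r u hu
    exact ⟨p', hne, by rw [(hc.2 p' hp').1, hr]⟩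
  -- As long as `K` is frozen, either some continuation reaches a global deadlock, or an enabled
  -- process always exists and the fewest-moves schedule never stops.
  by_cases hglob : ∃ c, Inv c ∧ ∀ p, ¬ Enabled A B c.1 c.2 p
  · obtain ⟨c, hc, h⟩ := hglob
    exact Or.inl (hasGlobalDeadlock_iff.2 ⟨c.1, c.2, hc.1, h⟩)
  push Not at hglob
  have hnext : ∀ (c : {c // Inv c}) (cnt : Proc n → ℕ), ∃ (p : Proc n) (c' : {c // Inv c}),
      Move A B p c.1 c'.1 ∧ ∀ p', Enabled A B c.1.1 c.1.2 p' → cnt p ≤ cnt p' := by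
    rintro ⟨c, hc⟩ cnt
    obtain ⟨p, ⟨s', hp⟩, hmin⟩ := Set.exists_min_image {p | Enabled A B c.1 c.2 p} cnt
      (Set.toFinite _) (hglob c hc)
    refine ⟨p, ⟨(s', c.2), hc.1.step hp, fun p' hp' => ⟨?_, (hc.2 p' hp').2⟩⟩,
      ⟨hp, fun _ _ => rfl⟩, hmin⟩
    have hne : p' ≠ p := fun h => hdis c hc p' hp' (h ▸ ⟨s', hp⟩)
    obtain ⟨-, -, -, h⟩ := step_iff.1 hp
    exact (h p' hne).trans (hc.2 p' hp').1
  choose mv nx hmv hmn using hnext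
  classical
  let st : ℕ → {c // Inv c} × (Proc n → ℕ) := fun t =>
    Nat.rec (⟨(s, e), hs, fun _ _ => ⟨rfl, rfl⟩⟩, fun _ => 0)
      (fun _ z => (nx z.1 z.2, Function.update z.2 (mv z.1 z.2) (z.2 (mv z.1 z.2) + 1))) t
  obtain ⟨p₀, hp₀⟩ := hK
  obtain ⟨x, hx, hfair, hdl, -⟩ := exists_isRun_of_moves_of_disabled (A := A) (B := B)
    (y := fun t => (st t).1.1) (m := fun t => mv (st t).1 (st t).2) hs
    (fun t => hmv (st t).1 (st t).2) (p₀ := p₀) (fun t => hdis _ (st t).1.2 p₀ hp₀)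
    (fun p hp => frequently_of_minimal_count (cnt := fun t => (st t).2)
      (fun t => by simp [st]) (fun t p hp => by simp [st] at hp ⊢; simp [hp])
      (fun t p h => hmn (st t).1 (st t).2 p h) hp)
  exact Or.inr ⟨x, hx, hfair, hinit x hx hfair, p₀, hdl⟩

end Schedules

/-! ### Closed walks and their periodic repetition -/

section Walks

variable {V P : Type*}

/-- Walks in a labelled transition system; the list records the sources and the labels. -/
inductive Walk (St : P → V → V → Prop) : V → List (V × P) → V → Prop
  | nil (v : V) : Walk St v [] v
  | cons {p : P} {v w v' : V} {l : List (V × P)} :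
      St p v w → Walk St w l v' → Walk St v ((v, p) :: l) v'

variable {St : P → V → V → Prop}

theorem Walk.append {u v w : V} {l l' : List (V × P)} (h : Walk St u l v) (h' : Walk St v l' w) :
    Walk St u (l ++ l') w := by
  induction h with
  | nil => exact h'
  | cons hst _ ih => exact .cons hst (ih h')

theorem Walk.head_eq {v w : V} {l : List (V × P)} (h : Walk St v l w) (hl : 0 < l.length) :
    l[0].1 = v := by
  cases h with
  | nil => simp at hl
  | cons => rfl

theorem Walk.step_getElem {v w : V} {l : List (V × P)} (h : Walk St v l w) :
    ∀ i (hi : i < l.length), St l[i].2 l[i].1 (if h : i + 1 < l.length then l[i + 1].1 else w) := by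
  induction h with
  | nil => intro i hi; simp at hi
  | @cons p v w v' l hst hw ih =>
    rintro (_ | i) hi
    · by_cases hl : 0 < l.length
      · simpa [hl, hw.head_eq hl] using hst
      · cases hw with
        | nil => simpa using hst
        | cons => simp at hl
    · simpa using ih i (by simpa using hi)

/-- A nonempty closed walk can be repeated for ever. -/
theorem Walk.exists_periodic {v : V} {l : List (V × P)} (h : Walk St v l v) (hl : l ≠ []) :
    ∃ (y : ℕ → V) (m : ℕ → P), y 0 = v ∧ (∀ t, St (m t) (y t) (y (t + 1))) ∧
      ∀ a ∈ l, ∃ᶠ t in atTop, y t = a.1 ∧ m t = a.2 := by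
  have hpos : 0 < l.length := List.length_pos_iff.2 hl
  have hlt : ∀ t, t % l.length < l.length := fun t => Nat.mod_lt t hpos
  refine ⟨fun t => (l[t % l.length]'(hlt t)).1, fun t => (l[t % l.length]'(hlt t)).2, ?_,
    fun t => ?_, fun a ha => ?_⟩
  · simpa using h.head_eq hpos
  · have := h.step_getElem _ (hlt t)
    convert this using 1
    split_ifs with h1
    · have : (t + 1) % l.length = t % l.length + 1 := by
        rw [Nat.add_mod]
        rcases Nat.lt_or_ge 1 l.length with h2 | h2
        · rw [Nat.mod_eq_of_lt h2, Nat.mod_eq_of_lt h1]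
        · have := hlt t; omega
      simp only [this]
    · have h2 : t % l.length + 1 = l.length := by have := hlt t; omega
      have : (t + 1) % l.length = 0 := by
        rw [← Nat.mod_add_mod, h2, Nat.mod_self]
      simp only [this]
      exact h.head_eq hpos
  · obtain ⟨i, hi, rfl⟩ := List.mem_iff_getElem.1 ha
    rw [frequently_atTop]
    intro T
    refine ⟨i + l.length * T, by nlinarith, ?_⟩
    have : (i + l.length * T) % l.length = i := by
      rw [Nat.add_mul_mod_self_left, Nat.mod_eq_of_lt hi]
    simp only [this, and_self]

/-- Closed walks at a common base point can be concatenated, so each process may be served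
separately. -/
theorem exists_walk_of_forall {v : V} {S : Set P} [Finite P] {Good : P → V → Prop}
    (h : ∀ p ∈ S, ∃ l, Walk St v l v ∧ ∃ v', (v', p) ∈ l ∧ Good p v') :
    ∃ l, Walk St v l v ∧ ∀ p ∈ S, ∃ v', (v', p) ∈ l ∧ Good p v' := by
  induction S, Set.toFinite S using Set.Finite.induction_on with
  | empty => exact ⟨[], .nil v, by simp⟩
  | @insert p S _ _ ih =>
    obtain ⟨l, hl, hS⟩ := ih fun q hq => h q (Set.mem_insert_of_mem _ hq)
    obtain ⟨l', hl', v', hv', hg⟩ := h p (Set.mem_insert _ _)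
    refine ⟨l ++ l', hl.append hl', ?_⟩
    rintro q (rfl | hq)
    · exact ⟨v', List.mem_append_right _ hv', hg⟩
    · obtain ⟨w, hw, hgw⟩ := hS q hq
      exact ⟨w, List.mem_append_left _ hw, hgw⟩

end Walks

/-! ### Construction of a lasso-shaped local deadlock -/

section Lasso

variable {QA QB IA IB : Type*} (A : ProcessTemplate QA QB QA IA) (B : ProcessTemplate QA QB QB IB)
  {n N : ℕ}

/-- A local transition, together with the choice of the next input, whose guard does not exclude
a state in `F`. -/
def LocalStep (F : Set (QA ⊕ QB)) (a b : (QA ⊕ QB) × (IA ⊕ IB)) : Prop :=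
  (∃ r ∉ F, LocalTrans A B a.1 a.2 {r}ᶜ b.1) ∧ b.2.isLeft = a.2.isLeft

variable {A B}

/-- The guard excludes one state, which is non-initial and outside `F`; no other process is there,
so the local step lifts to a global move. -/
theorem LocalStep.exists_move (hAB : IsOneConjunctive A B) {F : Set (QA ⊕ QB)}
    {a b : (QA ⊕ QB) × (IA ⊕ IB)} (h : LocalStep A B F a b)
    {c : Global QA QB n × Global IA IB n} {p : Proc n} (hc : (c.1.at p, c.2.at p) = a)
    (hF : ∀ p' ≠ p, c.1.at p' ∈ F ∨ IsInitial A B (c.1.at p')) :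
    ∃ c', Move A B p c c' ∧ (c'.1.at p, c'.2.at p) = b ∧
      ∀ p' ≠ p, c'.1.at p' = c.1.at p' ∧ c'.2.at p' = c.2.at p' := by
  subst hc
  obtain ⟨⟨r, hr, htr⟩, hb⟩ := h
  obtain ⟨s', hs, hs'⟩ := c.1.exists_update p b.1 htr.isLeft_eq.1
  obtain ⟨e', he, he'⟩ := c.2.exists_update p b.2 hb
  refine ⟨(s', e'), ⟨step_iff.2 ⟨{r}ᶜ, hs ▸ htr, ?_, hs'⟩, he'⟩, by simp [hs, he],
    fun p' hp' => ⟨hs' p' hp', he' p' hp'⟩⟩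
  rintro p' hp' rfl
  rcases hF p' hp' with h | h
  · exact hr h
  · obtain ⟨r', hr', heq⟩ := htr.guard hAB
    obtain rfl : c.1.at p' = r' := by simpa using heq
    exact hr' h

/-- The configurations in which the processes in `K` are as in `c₀`, and each state in `R` is
occupied by a process outside of `K`. -/
def Safe (K : Set (Proc n)) (R : Set QB) (c₀ c : Global QA QB n × Global IA IB n) : Prop :=
  (∀ p ∈ K, c.1.at p = c₀.1.at p ∧ c.2.at p = c₀.2.at p) ∧ ∀ r ∈ R, ∃ p ∉ K, c.1.at p = .inr r

/-- One process follows a path of its template while all others stay. -/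
theorem exists_walk_of_transGen (hAB : IsOneConjunctive A B) {F : Set (QA ⊕ QB)}
    {K : Set (Proc n)} {R : Set QB} {c₀ : Global QA QB n × Global IA IB n} {p : Proc n}
    (hpK : p ∉ K) {a b : (QA ⊕ QB) × (IA ⊕ IB)} (h : Relation.TransGen (LocalStep A B F) a b) :
    ∀ c : Global QA QB n × Global IA IB n, (c.1.at p, c.2.at p) = a →
      (∀ p' ≠ p, c.1.at p' ∈ F ∨ IsInitial A B (c.1.at p')) →
      (∀ p ∈ K, c.1.at p = c₀.1.at p ∧ c.2.at p = c₀.2.at p) →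
      (∀ r ∈ R, ∃ p' ∉ K, p' ≠ p ∧ c.1.at p' = .inr r) →
      ∃ l c', Walk (fun p c c' => Move A B p c c' ∧ Safe K R c₀ c) c ((c, p) :: l) c' ∧
        (c'.1.at p, c'.2.at p) = b ∧
        ∀ p' ≠ p, c'.1.at p' = c.1.at p' ∧ c'.2.at p' = c.2.at p' := by
  induction h using Relation.TransGen.head_induction_on with
  | single h =>
    intro c hc hF hK hR
    obtain ⟨c', hm, hb, hoff⟩ := h.exists_move hAB hc hF
    exact ⟨[], c', .cons ⟨hm, hK, fun r hr => (hR r hr).imp fun _ h => ⟨h.1, h.2.2⟩⟩ (.nil _),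
      hb, hoff⟩
  | head h _ ih =>
    intro c hc hF hK hR
    obtain ⟨c', hm, hb, hoff⟩ := h.exists_move hAB hc hF
    obtain ⟨l, c'', hw, hb', hoff'⟩ := ih c' hb
      (fun p' hp' => by rw [(hoff p' hp').1]; exact hF p' hp')
      (fun p' hp' => by
        have := hoff p' fun h => hpK (h ▸ hp')
        rw [this.1, this.2]; exact hK p' hp')
      (fun r hr => by
        obtain ⟨p', h1, h2, h3⟩ := hR r hr
        exact ⟨p', h1, h2, by rw [(hoff p' h2).1, h3]⟩)
    exact ⟨_, c'', .cons ⟨hm, hK, fun r hr => (hR r hr).imp fun _ h => ⟨h.1, h.2.2⟩⟩ hw, hb',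
      fun p' hp' => ⟨(hoff' p' hp').1.trans (hoff p' hp').1,
        (hoff' p' hp').2.trans (hoff p' hp').2⟩⟩

theorem config_ext {c c' : Global QA QB n × Global IA IB n}
    (h : ∀ p, c.1.at p = c'.1.at p ∧ c.2.at p = c'.2.at p) : c = c' :=
  Prod.ext (Global.ext_at fun p => (h p).1) (Global.ext_at fun p => (h p).2)

/-- A local deadlock on a lasso-shaped run: the processes in `K` stay disabled, and the others
return to the base configuration infinitely often, in turns that keep the states in `R` occupied. -/
theorem hasFairLocalDeadlock_of_lasso (hAB : IsOneConjunctive A B) {F : Set (QA ⊕ QB)}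
    {K : Set (Proc n)} {R : Set QB} {s : Global QA QB n} {e : Global IA IB n}
    (hs : Reachable A B s) (hK : K.Nonempty) (hK' : K ≠ Set.univ)
    (hF : ∀ p, s.at p ∈ F ∨ IsInitial A B (s.at p)) (hRF : ∀ r ∈ R, Sum.inr r ∈ F)
    (hblock : ∀ p ∈ K, ∀ r u, LocalTrans A B (s.at p) (e.at p) {r}ᶜ u →
      (∃ p' ∈ K, p' ≠ p ∧ s.at p' = r) ∨ ∃ r₀ ∈ R, r = .inr r₀)
    (hmoving : ∀ p ∉ K, s.at p = initAt A B p ∨ ∃ r ∈ R, s.at p = .inr r)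
    (hhome : ∀ p ∉ K, ∀ v : IA ⊕ IB, v.isLeft = (e.at p).isLeft →
      Relation.TransGen (LocalStep A B F) (s.at p, e.at p) (initAt A B p, v))
    (hR : ∀ r ∈ R, ∃ p ∉ K, s.at p = .inr r) (hRinit : B.init ∉ R)
    (hfresh : R.Nonempty → ∃ p ∉ K, s.at p = .inr B.init)
    (hout : ∀ r ∈ R, ∃ σ : IB, ∀ σ' : IB, Relation.TransGen (LocalStep A B F)
      (.inr B.init, .inr σ) (.inr r, .inr σ')) :
    HasFairLocalDeadlock A B n := by
  have hloop : ∀ p ∈ Kᶜ, ∃ l, Walk (fun p c c' => Move A B p c c' ∧ Safe K R (s, e) c)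
      (s, e) l (s, e) ∧ ∃ c', (c', p) ∈ l ∧ c'.1.at p = initAt A B p := by
    intro p hp
    rcases hmoving p hp with hinit | ⟨r, hr, hpr⟩
    -- A process at home runs its cycle alone. It occupies no state of `R`, so its absence uncovers
    -- none.
    · obtain ⟨l, c', hw, hb, hoff⟩ := exists_walk_of_transGen (R := R) (c₀ := (s, e)) hAB hp
        (hhome p hp (e.at p) rfl) (s, e) rfl (fun p' _ => hF p') (fun _ _ => ⟨rfl, rfl⟩)
        (fun r hr => by
          obtain ⟨p', hp', h⟩ := hR r hr
          refine ⟨p', hp', ?_, h⟩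
          rintro rfl
          rw [hinit] at h
          have := isInitial_initAt A B p'
          rw [h] at this
          exact hRinit (this ▸ hr))
      have : c' = (s, e) := config_ext fun p' => by
        by_cases hpp : p' = p
        · subst hpp
          simp only [Prod.mk.injEq] at hb
          exact ⟨hb.1.trans hinit.symm, hb.2⟩
        · exact hoff p' hpp
      subst this
      exact ⟨_, hw, (s, e), List.mem_cons_self, hinit⟩
    · -- exchange `p` with a process `z` in the initial state, and exchange them back
      obtain ⟨z, hz, hzinit⟩ := hfresh ⟨r, hr⟩
      have hrinit : r ≠ B.init := fun h => hRinit (h ▸ hr)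
      have hzp : z ≠ p := by
        rintro rfl
        rw [hzinit] at hpr
        exact hrinit (by simpa using hpr.symm)
      obtain ⟨iz, rfl⟩ : ∃ i, z = .B i := by
        cases z with
        | A => simp [Global.at] at hzinit
        | B i => exact ⟨i, rfl⟩
      obtain ⟨ip, rfl⟩ : ∃ i, p = .B i := by
        cases p with
        | A => simp [Global.at] at hpr
        | B i => exact ⟨i, rfl⟩
      -- The path from the initial state to `r` starts with the input `σ`. So `z` first runs its
      -- home cycle to acquire `σ`, and `p` goes home choosing `σ` in order to be able to return. On
      -- entering `r`, `z` takes over the input of `p`, so that the way home of `p` is open to `z`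
      -- as well.
      obtain ⟨σ, hσ⟩ := hout r hr
      have hz1 := hhome _ hz (.inr σ) rfl
      have hp1 := hhome _ hp (.inr σ) rfl
      have hp2 := hhome _ hp (e.at (.B iz)) rfl
      rw [hpr] at hp1 hp2
      rw [hzinit] at hz1
      have hin := hσ (e.2 ip)
      have e1 := hz1.trans hin
      -- `z` enters `r`
      obtain ⟨l1, c1, hw1, hb1, hoff1⟩ := exists_walk_of_transGen (R := R) (c₀ := (s, e)) hAB hz
        e1 (s, e) (by simp [hzinit]) (fun p' _ => hF p') (fun _ _ => ⟨rfl, rfl⟩)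
        (fun r' hr' => by
          obtain ⟨p', hp', h⟩ := hR r' hr'
          refine ⟨p', hp', ?_, h⟩
          rintro rfl
          rw [hzinit] at h
          exact hRinit (by rwa [← Sum.inr.inj h] at hr'))
      simp only [Prod.mk.injEq] at hb1
      have hF1 : ∀ p', c1.1.at p' ∈ F ∨ IsInitial A B (c1.1.at p') := fun p' => by
        by_cases h : p' = .B iz
        · subst h
          rw [hb1.1]; exact Or.inl (hRF r hr)
        · rw [(hoff1 p' h).1]; exact hF p'
      have hK1 : ∀ p' ∈ K, c1.1.at p' = s.at p' ∧ c1.2.at p' = e.at p' :=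
        fun p' hp' => hoff1 p' fun h => hz (h ▸ hp')
      -- `p` leaves `r`
      obtain ⟨l2, c2, hw2, hb2, hoff2⟩ := exists_walk_of_transGen (R := R) (c₀ := (s, e)) hAB hp
        hp1 c1 (by
          rw [(hoff1 _ hzp.symm).1, (hoff1 _ hzp.symm).2]
          simp [hpr]) (fun p' _ => hF1 p') hK1
        (fun r' hr' => by
          by_cases hrr : r' = r
          · exact ⟨_, hz, hzp, by rw [hb1.1, hrr]⟩
          · obtain ⟨p', hp', h⟩ := hR r' hr'
            have h1 : p' ≠ .B ip := by
              rintro rfl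
              rw [hpr] at h
              exact hrr (Sum.inr.inj h).symm
            have h2 : p' ≠ .B iz := by
              rintro rfl
              rw [hzinit] at h
              exact hRinit (by rwa [← Sum.inr.inj h] at hr')
            exact ⟨p', hp', h1, by rw [(hoff1 p' h2).1, h]⟩)
      simp only [Prod.mk.injEq] at hb2
      -- `p` returns to `r`
      obtain ⟨l3, c3, hw3, hb3, hoff3⟩ := exists_walk_of_transGen (R := R) (c₀ := (s, e)) hAB hp
        hin c2 (by rw [hb2.1, hb2.2]; rfl)
        (fun p' hp' => by rw [(hoff2 p' hp').1]; exact hF1 p')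
        (fun p' hp' => by
          have := hoff2 p' fun h => hp (h ▸ hp')
          rw [this.1, this.2]; exact hK1 p' hp')
        (fun r' hr' => by
          by_cases hrr : r' = r
          · exact ⟨_, hz, hzp, by rw [(hoff2 _ hzp).1, hb1.1, hrr]⟩
          · obtain ⟨p', hp', h⟩ := hR r' hr'
            have h1 : p' ≠ .B ip := by
              rintro rfl
              rw [hpr] at h
              exact hrr (Sum.inr.inj h).symm
            have h2 : p' ≠ .B iz := by
              rintro rfl
              rw [hzinit] at h
              exact hRinit (by rwa [← Sum.inr.inj h] at hr')
            exact ⟨p', hp', h1, by rw [(hoff2 p' h1).1, (hoff1 p' h2).1, h]⟩)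
      simp only [Prod.mk.injEq] at hb3
      have hc31 : c3 = c1 := config_ext fun p' => by
        by_cases h : p' = .B ip
        · subst h
          rw [hb3.1, hb3.2, (hoff1 _ hzp.symm).1, (hoff1 _ hzp.symm).2]
          exact ⟨hpr.symm, rfl⟩
        · rw [(hoff3 p' h).1, (hoff3 p' h).2, (hoff2 p' h).1, (hoff2 p' h).2]
          exact ⟨rfl, rfl⟩
      subst hc31
      -- `z` leaves `r`
      obtain ⟨l4, c4, hw4, hb4, hoff4⟩ := exists_walk_of_transGen (R := R) (c₀ := (s, e)) hAB hz
        hp2 c3 (by rw [hb1.1, hb1.2]; rfl) (fun p' _ => hF1 p') hK1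
        (fun r' hr' => by
          obtain ⟨p', hp', h⟩ := hR r' hr'
          have h2 : p' ≠ .B iz := by
            rintro rfl
            rw [hzinit] at h
            exact hRinit (by rwa [← Sum.inr.inj h] at hr')
          exact ⟨p', hp', h2, by rw [(hoff1 p' h2).1, h]⟩)
      simp only [Prod.mk.injEq] at hb4
      have hc4 : c4 = (s, e) := config_ext fun p' => by
        by_cases h : p' = .B iz
        · subst h
          exact ⟨hb4.1.trans hzinit.symm, hb4.2⟩
        · exact ⟨(hoff4 p' h).1.trans (hoff1 p' h).1, (hoff4 p' h).2.trans (hoff1 p' h).2⟩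
      subst hc4
      exact ⟨_, ((hw1.append hw2).append hw3).append hw4, c2, by simp, hb2.1⟩
  obtain ⟨l, hw, hl⟩ := exists_walk_of_forall hloop
  obtain ⟨p₁, hp₁⟩ : Kᶜ.Nonempty := Set.nonempty_compl.2 hK'
  have hne : l ≠ [] := by
    rintro rfl
    obtain ⟨_, h, -⟩ := hl p₁ hp₁
    simp at h
  obtain ⟨y, m, hy0, hy, hfreq⟩ := hw.exists_periodic hne
  have hdis : ∀ p ∈ K, ∀ t, ¬ Enabled A B (y t).1 (y t).2 p := by
    intro p hp t
    obtain ⟨-, hsafe, hocc⟩ := hy t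
    rw [not_enabled_iff hAB]
    intro r u hu
    rw [(hsafe p hp).1, (hsafe p hp).2] at hu
    rcases hblock p hp r u hu with ⟨p', hp', h1, h2⟩ | ⟨r₀, hr₀, rfl⟩
    · exact ⟨p', h1, by rw [(hsafe p' hp').1]; exact h2⟩
    · obtain ⟨p', hp', h⟩ := hocc r₀ hr₀
      exact ⟨p', fun h => hp' (h ▸ hp), h⟩
  have hmove : ∀ p ∉ K, ∃ᶠ t in atTop, (y t).1.at p = initAt A B p ∧ m t = p := by
    intro p hp
    obtain ⟨c', hc', hg⟩ := hl p hp
    refine (hfreq _ hc').mono ?_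
    rintro t ⟨h1, h2⟩
    exact ⟨by rw [h1]; exact hg, h2⟩
  obtain ⟨p₀, hp₀⟩ := hK
  obtain ⟨x, hx, hfair, hdl, k, hk⟩ := exists_isRun_of_moves_of_disabled (A := A) (B := B)
    (y := y) (m := m) (by rw [hy0]; exact hs) (fun t => (hy t).1) (hdis p₀ hp₀)
    (fun p hp => by
      by_cases hpK : p ∈ K
      · exact absurd hp (by simp [hdis p hpK])
      · exact (hmove p hpK).mono fun t h => h.2)
  have hmap : map (fun t => t + k) atTop = (atTop : Filter ℕ) := map_add_atTop_eq_nat k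
  refine ⟨x, hx, hfair, fun p hp => ?_, p₀, hdl⟩
  by_cases hpK : p ∈ K
  · rw [MovesInfinitelyOften, ← hmap, frequently_map] at hp
    obtain ⟨t, ht⟩ := hp.exists
    rw [hk] at ht
    have hmt : m t = p := WithBot.coe_injective ht
    exact absurd (hmt ▸ (hy t).1.enabled) (hdis p hpK t)
  · rw [← hmap, frequently_map]
    refine (hmove p hpK).mono fun t ht => ?_
    rw [hk]
    exact (isInitial_at_iff A B).2 ht.1

end Lasso

/-! ### Limit behaviour of a locally deadlocked run -/

section Extraction

variable {QA QB IA IB : Type*} (A : ProcessTemplate QA QB QA IA) (B : ProcessTemplate QA QB QB IB)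
  {n N : ℕ}

/-- A local transition, for some input, whose guard does not exclude a state in `F`. -/
def StateStep (F : Set (QA ⊕ QB)) (u u' : QA ⊕ QB) : Prop :=
  ∃ v, ∃ r ∉ F, LocalTrans A B u v {r}ᶜ u'

/-- The states of the processes in `D`, and the states in `R`. -/
def occupied (s : Global QA QB n) (D : Set (Proc n)) (R : Set QB) : Set (QA ⊕ QB) :=
  s.at '' D ∪ Sum.inr '' R

/-- What the limit behaviour of a fair initializing locally deadlocked run provides: `D` is the set
of the processes that are stuck, and `R` the set of the other states that are occupied from some
moment on, by processes that keep moving. -/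
structure IsStuckConfig (s : Global QA QB n) (e : Global IA IB n) (D : Set (Proc n))
    (R : Set QB) : Prop where
  reachable : Reachable A B s
  nonempty : D.Nonempty
  ne_univ : D ≠ Set.univ
  fst_eq : .A ∉ D → s.1 = A.init
  init_notMem : B.init ∉ R
  disjoint : ∀ r ∈ R, Sum.inr r ∉ s.at '' D
  exists_at : ∀ r ∈ R, ∃ b, s.2 b = r
  blocked : ∀ d ∈ D, ∀ r u, LocalTrans A B (s.at d) (e.at d) {r}ᶜ u →
    (∃ p ≠ d, s.at p = r) ∧ r ∈ occupied s D R
  home : ∀ p ∉ D, Relation.TransGen (StateStep A B (occupied s D R)) (initAt A B p) (initAt A B p)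
  leave : ∀ r ∈ R, Relation.TransGen (StateStep A B (occupied s D R)) (.inr r) (.inr B.init)
  enter : ∀ r ∈ R, Relation.TransGen (StateStep A B (occupied s D R)) (.inr B.init) (.inr r)

variable {A B}

/-- Each transition reads the current input and chooses the next one freely. Hence the first
transition dictates the input at the start, and the input at the end is arbitrary. -/
theorem exists_transGen_localStep {F : Set (QA ⊕ QB)} {u u' : QA ⊕ QB}
    (h : Relation.TransGen (StateStep A B F) u u') :
    ∃ v : IA ⊕ IB, v.isLeft = u.isLeft ∧ ∀ v' : IA ⊕ IB, v'.isLeft = u.isLeft →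
      Relation.TransGen (LocalStep A B F) (u, v) (u', v') := by
  induction h using Relation.TransGen.head_induction_on with
  | single h =>
    obtain ⟨v, r, hr, h⟩ := h
    exact ⟨v, h.isLeft_eq.2, fun v' hv' => .single ⟨⟨r, hr, h⟩, by simp [hv', h.isLeft_eq.2]⟩⟩
  | head h _ ih =>
    obtain ⟨v, r, hr, h⟩ := h
    obtain ⟨w, hw, ih⟩ := ih
    have hl := h.isLeft_eq
    exact ⟨v, hl.2, fun v' hv' => .head (b := (_, w))
      ⟨⟨r, hr, h⟩, by simp only; rw [hw, hl.1, hl.2]⟩ (ih v' (hv'.trans hl.1.symm))⟩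

/-- By strong fairness the processes that move finitely often are eventually disabled, and from then
on frozen. The remaining processes witness the local paths: projecting the run to one of them gives
paths to and from its initial state. -/
theorem HasFairLocalDeadlock.exists_isStuckConfig (hAB : IsOneConjunctive A B)
    (h : HasFairLocalDeadlock A B n) :
    ∃ (s : Global QA QB n) (e : Global IA IB n) (D : Set (Proc n)) (R : Set QB),
      IsStuckConfig A B s e D R := by
  obtain ⟨x, hx, hfair, hini, p₀, hp₀⟩ := h
  set D : Set (Proc n) := {p | ¬ MovesInfinitelyOften x p} with hD
  have hstep : ∀ t, ∃ p : Proc n, (x t).mover = (p : WithBot (Proc n)) ∧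
      Step A B (x t).state (x t).input p (x (t + 1)).state := fun t =>
    (hx.1.1 t (ENat.natCast_lt_top _)).1
  have hinput : ∀ t p, (x (t + 1)).input.at p = (x t).input.at p ∨
      (x t).mover = (p : WithBot (Proc n)) := fun t => (hx.1.1 t (ENat.natCast_lt_top _)).2
  have hdisab : ∀ᶠ t in atTop, ∀ p ∈ D, ¬ Enabled A B (x t).state (x t).input p := by
    refine eventually_all.2 fun p => ?_
    by_cases hp : p ∈ D
    · exact (not_frequently.1 fun h => hp (hfair p h)).mono fun t h _ => h
    · exact Eventually.of_forall fun t h => absurd h hp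
  obtain ⟨T, hT⟩ := eventually_atTop.1 hdisab
  have hvisit : ∀ p ∉ D, ∀ t, ∃ t' ≥ t, (x t').state.at p = initAt A B p := by
    intro p hp t
    obtain ⟨t', ht', h⟩ := frequently_atTop.1 (hini p (not_not.1 hp)) t
    exact ⟨t', ht', (isInitial_at_iff A B).1 h⟩
  -- There is only one copy of `A`, so no fresh one can replace it: if it moves, the snapshot is
  -- taken when it is at home.
  obtain ⟨t₀, ht₀, hA⟩ : ∃ t₀ ≥ T, .A ∉ D → (x t₀).state.1 = A.init := by
    by_cases h : .A ∈ D
    · exact ⟨T, le_rfl, fun h' => absurd h h'⟩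
    · obtain ⟨t', ht', h'⟩ := hvisit _ h T
      exact ⟨t', ht', fun _ => by simpa [Global.at, initAt] using h'⟩
  replace hT : ∀ t ≥ t₀, ∀ p ∈ D, ¬ Enabled A B (x t).state (x t).input p :=
    fun t ht => hT t (ht₀.trans ht)
  have hmover : ∀ t ≥ t₀, ∀ p : Proc n, (x t).mover = (p : WithBot (Proc n)) → p ∉ D := by
    intro t ht p hp hpD
    obtain ⟨p', hp', hs⟩ := hstep t
    rw [hp] at hp'
    obtain rfl := WithBot.coe_injective hp'
    exact hT t ht p hpD ⟨_, hs⟩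
  have hconst : ∀ d ∈ D, ∀ t ≥ t₀, (x t).state.at d = (x t₀).state.at d ∧
      (x t).input.at d = (x t₀).input.at d := by
    intro d hd t ht
    induction t, ht using Nat.le_induction with
    | base => exact ⟨rfl, rfl⟩
    | succ t ht ih =>
      obtain ⟨p, hp, hs⟩ := hstep t
      obtain ⟨-, -, -, hoff⟩ := step_iff.1 hs
      have hne : d ≠ p := fun h => hmover t ht p hp (h ▸ hd)
      refine ⟨(hoff d hne).trans ih.1, ?_⟩
      rcases hinput t d with h | h
      · exact h.trans ih.2
      · exact absurd hd (hmover t ht d h)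
  set s := (x t₀).state with hs
  set R : Set QB := {r | r ≠ B.init ∧ Sum.inr r ∉ s.at '' D ∧
    ∀ t ≥ t₀, ∃ b, (x t).state.2 b = r} with hR
  have hRD : ∀ r ∈ R, ∀ t ≥ t₀, ∀ p, (x t).state.at p = .inr r → p ∉ D := by
    intro r hr t ht p hp hpD
    exact hr.2.1 ⟨p, hpD, by rw [← (hconst p hpD t ht).1, hp]⟩
  -- from `t₀` on, a move is a `StateStep`, or it does not change the state, which is then in `R`
  have hmoves : ∀ t ≥ t₀, ∀ p : Proc n, (x t).mover = (p : WithBot (Proc n)) →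
      StateStep A B (occupied s D R) ((x t).state.at p) ((x (t + 1)).state.at p) ∨
      (x (t + 1)).state.at p = (x t).state.at p ∧ ∃ r ∈ R, (x t).state.at p = .inr r := by
    intro t ht p hp
    obtain ⟨p', hp', hs'⟩ := hstep t
    rw [hp] at hp'
    obtain rfl := WithBot.coe_injective hp'
    obtain ⟨g, htr, hsat, hoff⟩ := step_iff.1 hs'
    obtain ⟨r, -, rfl⟩ := htr.guard hAB
    rw [guardSat_compl] at hsat
    by_cases hr : r ∈ occupied s D R
    · right
      rcases hr with ⟨d, hd, rfl⟩ | ⟨r, hr, rfl⟩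
      · exact absurd (hconst d hd t ht).1 (hsat d fun h => hmover t ht p hp (h ▸ hd))
      -- The guard says that nobody but the mover is in `r`, while `r` is occupied both before and
      -- after the move. So the mover is in `r` at both times, and its move can be omitted from the
      -- path.
      · obtain ⟨b, hb⟩ := hr.2.2 t ht
        obtain rfl : Proc.B b = p := by
          by_contra h
          exact hsat _ h (by simp [Global.at, hb])
        obtain ⟨b', hb'⟩ := hr.2.2 (t + 1) (ht.trans (Nat.le_succ t))
        have hb'b : Proc.B b' = Proc.B (n := n) b := by
          by_contra h
          refine hsat _ h ?_
          rw [← hoff _ h]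
          simp [Global.at, hb']
        obtain rfl : b' = b := by simpa using hb'b
        exact ⟨by simp [Global.at, hb, hb'], r, hr, by simp [Global.at, hb]⟩
    · exact Or.inl ⟨_, r, hr, htr⟩
  have hpath : ∀ p, ∀ t ≥ t₀, ∀ t' ≥ t, Relation.ReflTransGen (StateStep A B (occupied s D R))
      ((x t).state.at p) ((x t').state.at p) := by
    intro p t ht t' htt'
    induction t', htt' using Nat.le_induction with
    | base => exact .refl
    | succ t' htt' ih =>
      obtain ⟨p', hp', hs'⟩ := hstep t'
      by_cases hpp : p = p'
      · subst hpp
        rcases hmoves t' (ht.trans htt') p hp' with h | ⟨h, -⟩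
        · exact ih.tail h
        · rwa [h]
      · obtain ⟨-, -, -, hoff⟩ := step_iff.1 hs'
        rwa [hoff p hpp]
  -- The occupant of `r` may change with time, but among finitely many copies one is there
  -- infinitely often.
  have hcycle : ∀ r ∈ R, ∃ b, .B b ∉ D ∧ ∃ᶠ t in atTop, (x t).state.2 b = r := by
    intro r hr
    obtain ⟨b, hb⟩ : ∃ b, ∃ᶠ t in atTop, (x t).state.2 b = r := by
      by_contra! h
      obtain ⟨t, h1, h2⟩ := ((eventually_all.2 h).and (eventually_ge_atTop t₀)).exists
      obtain ⟨b, hb⟩ := hr.2.2 t h2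
      exact h1 b hb
    refine ⟨b, ?_, hb⟩
    obtain ⟨t, ht, h⟩ := frequently_atTop.1 hb t₀
    exact hRD r hr t ht _ (by simp [Global.at, h])
  refine ⟨s, (x t₀).input, D, R, hx.reachable t₀ (ENat.natCast_lt_top _), ⟨p₀, fun h => ?_⟩, fun h => ?_,
    hA, fun h => h.1 rfl, fun r hr => hr.2.1, fun r hr => hr.2.2 t₀ le_rfl, ?_, ?_, ?_, ?_⟩
  · obtain ⟨T', hT'⟩ := hp₀
    obtain ⟨t, ht, h⟩ := frequently_atTop.1 h T'
    obtain ⟨p', hp', hs'⟩ := hstep t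
    rw [h] at hp'
    obtain rfl := WithBot.coe_injective hp'
    exact hT' t ht ⟨_, hs'⟩
  · obtain ⟨p', hp', -⟩ := hstep t₀
    exact hmover t₀ le_rfl p' hp' (h ▸ Set.mem_univ _)
  · intro d hd r u htr
    have hocc : ∀ t ≥ t₀, ∃ p ≠ d, (x t).state.at p = r := by
      intro t ht
      rw [← (hconst d hd t ht).1, ← (hconst d hd t ht).2] at htr
      exact (not_enabled_iff hAB).1 (hT t ht d hd) r u htr
    refine ⟨hocc t₀ le_rfl, ?_⟩
    obtain ⟨r', hr', heq⟩ := htr.guard hAB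
    obtain rfl : r = r' := by simpa using heq
    by_cases hrD : r ∈ s.at '' D
    · exact Or.inl hrD
    right
    have hnD : ∀ t ≥ t₀, ∀ p, (x t).state.at p = r → p ∉ D := fun t ht p hp hpD =>
      hrD ⟨p, hpD, by rw [← (hconst p hpD t ht).1, hp]⟩
    -- A blocking state of `A` outside the stuck states would hold `A` for ever, although `A` moves
    -- and must visit its initial state.
    rcases r with a | r
    · have hAt : ∀ t ≥ t₀, (x t).state.at .A = .inl a ∧ Proc.A ∉ D := by
        intro t ht
        obtain ⟨p, -, hp⟩ := hocc t ht
        have := hnD t ht p hp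
        cases p with
        | A => exact ⟨hp, this⟩
        | B i => simp [Global.at] at hp
      obtain ⟨t, ht, h⟩ := hvisit .A (hAt t₀ le_rfl).2 t₀
      rw [(hAt t ht).1] at h
      exact absurd (h ▸ isInitial_initAt A B .A) hr'
    · refine ⟨r, ⟨fun h => hr' h, hrD, fun t ht => ?_⟩, rfl⟩
      obtain ⟨p, -, hp⟩ := hocc t ht
      cases p with
      | A => simp [Global.at] at hp
      | B i => exact ⟨i, by simpa [Global.at] using hp⟩
  · intro p hp
    obtain ⟨t₁, ht₁, h₁⟩ := hvisit p hp t₀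
    obtain ⟨t₂, ht₂, h₂⟩ := frequently_atTop.1 (not_not.1 hp) t₁
    obtain ⟨t₃, ht₃, h₃⟩ := hvisit p hp (t₂ + 1)
    have ht₂' : t₀ ≤ t₂ := le_trans ht₁ ht₂
    have hin := hpath p t₁ ht₁ t₂ ht₂
    have hout := hpath p (t₂ + 1) (ht₂'.trans (Nat.le_succ _)) t₃ ht₃
    rw [h₁] at hin
    rw [h₃] at hout
    rcases hmoves t₂ ht₂' p h₂ with h | ⟨h, r, hr, hpr⟩
    · exact (Relation.TransGen.tail' hin h).trans_left hout
    -- The omitted move happens in a state of `R`, which is not initial, so the way there was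
    -- already a nonempty path.
    · rw [h] at hout
      rcases Relation.reflTransGen_iff_eq_or_transGen.1 hin with h' | h'
      · have := isInitial_initAt A B p
        rw [← h', hpr] at this
        exact absurd this hr.1
      · exact h'.trans_left hout
  · intro r hr
    obtain ⟨b, hb, hbr⟩ := hcycle r hr
    obtain ⟨t₁, ht₁, h₁⟩ := frequently_atTop.1 hbr t₀
    obtain ⟨t₂, ht₂, h₂⟩ := hvisit _ hb t₁
    have := hpath (.B b) t₁ ht₁ t₂ ht₂
    rw [h₂] at this
    rcases Relation.reflTransGen_iff_eq_or_transGen.1 this with h' | h'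
    · simp [Global.at, initAt, h₁] at h'
      exact absurd h'.symm hr.1
    · simpa [Global.at, initAt, h₁] using h'
  · intro r hr
    obtain ⟨b, hb, hbr⟩ := hcycle r hr
    obtain ⟨t₁, ht₁, h₁⟩ := hvisit _ hb t₀
    obtain ⟨t₂, ht₂, h₂⟩ := frequently_atTop.1 hbr t₁
    have := hpath (.B b) t₁ ht₁ t₂ ht₂
    rw [h₁] at this
    rcases Relation.reflTransGen_iff_eq_or_transGen.1 this with h' | h'
    · simp [Global.at, initAt, h₂] at h'
      exact absurd h' hr.1
    · simpa [Global.at, initAt, h₂] using h'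

end Extraction

/-! ### Selecting and numbering the copies to keep -/

section Selection

variable {α : Type*} {n : ℕ}

/-- Two distinct indices in `S` have the value `a`, or as many as there are. -/
def CoversTwice (f : Fin n → α) (S : Finset (Fin n)) (a : α) : Prop :=
  (∀ b, f b = a → ∃ c ∈ S, f c = a) ∧
  ∀ b b', b ≠ b' → f b = a → f b' = a → ∃ c ∈ S, ∃ c' ∈ S, c ≠ c' ∧ f c = a ∧ f c' = a

theorem CoversTwice.mono {f : Fin n → α} {S T : Finset (Fin n)} {a : α} (hST : S ⊆ T)
    (h : CoversTwice f S a) : CoversTwice f T a :=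
  ⟨fun b hb => (h.1 b hb).imp fun _ hc => ⟨hST hc.1, hc.2⟩, fun b b' hne hb hb' => by
    obtain ⟨c, hc, c', hc', h⟩ := h.2 b b' hne hb hb'
    exact ⟨c, hST hc, c', hST hc', h⟩⟩

/-- From the fibre over each `a` take `w a` indices, or all of them if there are fewer. -/
theorem exists_selection [Fintype α] (f : Fin n → α) (w : α → ℕ) :
    ∃ S : Finset (Fin n), S.card ≤ ∑ a, w a ∧ (∀ b ∈ S, w (f b) ≠ 0) ∧
      (∀ b, 1 ≤ w (f b) → ∃ c ∈ S, f c = f b) ∧ ∀ a, 2 ≤ w a → CoversTwice f S a := by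
  classical
  have hsel : ∀ a, ∃ T ⊆ Finset.univ.filter (fun b => f b = a),
      T.card = min (w a) (Finset.univ.filter (fun b => f b = a)).card := fun a =>
    Finset.exists_subset_card_eq (min_le_right _ _)
  choose T hT hcard using hsel
  have hfT : ∀ a, ∀ b ∈ T a, f b = a := fun a b hb => by simpa using hT a hb
  have hTS : ∀ a, T a ⊆ Finset.univ.biUnion T := fun a =>
    Finset.subset_biUnion_of_mem T (Finset.mem_univ a)
  have hone : ∀ b, 1 ≤ w (f b) → ∃ c ∈ Finset.univ.biUnion T, f c = f b := by
    intro b hw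
    have h1 : 0 < (Finset.univ.filter (fun c => f c = f b)).card :=
      Finset.card_pos.2 ⟨b, by simp⟩
    have h2 : 0 < (T (f b)).card := by rw [hcard]; exact lt_min hw h1
    obtain ⟨c, hc⟩ := Finset.card_pos.1 h2
    exact ⟨c, hTS _ hc, hfT _ c hc⟩
  refine ⟨Finset.univ.biUnion T, Finset.card_biUnion_le.trans (Finset.sum_le_sum fun a _ => ?_),
    ?_, hone, fun a ha => ⟨?_, ?_⟩⟩
  · rw [hcard]; exact min_le_left _ _
  · intro b hb hw
    obtain ⟨a, -, ha⟩ := Finset.mem_biUnion.1 hb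
    obtain rfl := hfT a b ha
    have := hcard (f b)
    rw [hw, Nat.zero_min, Finset.card_eq_zero] at this
    simp [this] at ha
  · rintro b rfl
    exact hone b (by omega)
  · intro b b' hne hb hb'
    have h1 : 1 < (Finset.univ.filter (fun c => f c = a)).card :=
      Finset.one_lt_card.2 ⟨b, by simp [hb], b', by simp [hb'], hne⟩
    have h2 : 1 < (T a).card := by rw [hcard]; exact lt_min ha h1
    obtain ⟨c, hc, c', hc', hcc⟩ := Finset.one_lt_card.1 h2
    exact ⟨c, hTS _ hc, c', hTS _ hc', hcc, hfT _ _ hc, hfT _ _ hc'⟩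

theorem exists_enumeration {N : ℕ} (S : Finset (Fin n)) (hS : S.card ≤ N) :
    ∃ g : Fin N → Option (Fin n), (∀ i j b, g i = some b → g j = some b → i = j) ∧
      (∀ i b, g i = some b → b ∈ S) ∧ (∀ b ∈ S, ∃ i, g i = some b) ∧
      ∀ i, g i = none ↔ S.card ≤ i := by
  refine ⟨fun i => if h : i.1 < S.card then some (S.equivFin.symm ⟨i, h⟩).1 else none,
    fun i j b hi hj => ?_, fun i b hi => ?_, fun b hb => ?_, fun i => by simp⟩
  · simp only [Option.dite_none_right_eq_some, Option.some.injEq] at hi hj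
    obtain ⟨hi, rfl⟩ := hi
    obtain ⟨hj, h⟩ := hj
    have := S.equivFin.symm.injective (Subtype.ext h)
    exact Fin.ext (by simpa using this.symm)
  · simp only [Option.dite_none_right_eq_some, Option.some.injEq] at hi
    obtain ⟨hi, rfl⟩ := hi
    exact Subtype.property _
  · refine ⟨⟨S.equivFin ⟨b, hb⟩, (S.equivFin ⟨b, hb⟩).2.trans_le hS⟩, ?_⟩
    simp

end Selection

/-! ### Moving a stuck configuration to another number of copies -/

section Transfer

variable {QA QB IA IB : Type*} {A : ProcessTemplate QA QB QA IA} {B : ProcessTemplate QA QB QB IB}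
  {n N : ℕ} {s : Global QA QB n} {e : Global IA IB n} {D : Set (Proc n)} {R : Set QB}

theorem pullState_at_of_eq_some {g : Fin N → Option (Fin n)} {i : Fin N} {b : Fin n}
    (h : g i = some b) : (pullState B g s).at (.B i) = s.at (.B b) := by
  simp [pullState, Global.at, h]

theorem pullState_at_of_eq_none {g : Fin N → Option (Fin n)} {i : Fin N} (h : g i = none) :
    (pullState B g s).at (.B i) = .inr B.init := by
  simp [pullState, Global.at, h]

theorem exists_pullState_at {g : Fin N → Option (Fin n)} {S : Finset (Fin n)}
    (hg : ∀ b ∈ S, ∃ i, g i = some b) {r : QB} (hS : CoversTwice s.2 S r) {p : Proc n}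
    (hp : s.at p = .inr r) : ∃ i, (pullState B g s).at (.B i) = .inr r := by
  cases p with
  | A => simp [Global.at] at hp
  | B b =>
    obtain ⟨c, hc, hcr⟩ := hS.1 b (by simpa [Global.at] using hp)
    obtain ⟨i, hi⟩ := hg c hc
    exact ⟨i, by rw [pullState_at_of_eq_some hi]; simp [Global.at, hcr]⟩

theorem exists_two_pullState_at {g : Fin N → Option (Fin n)} {S : Finset (Fin n)}
    (hg : ∀ b ∈ S, ∃ i, g i = some b) {r : QB} (hS : CoversTwice s.2 S r) {p p' : Proc n}
    (hne : p ≠ p') (hp : s.at p = .inr r) (hp' : s.at p' = .inr r) :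
    ∃ i j, i ≠ j ∧ (pullState B g s).at (.B i) = .inr r ∧
      (pullState B g s).at (.B j) = .inr r := by
  cases p with
  | A => simp [Global.at] at hp
  | B b =>
    cases p' with
    | A => simp [Global.at] at hp'
    | B b' =>
      obtain ⟨c, hc, c', hc', hcc, hcr, hcr'⟩ := hS.2 b b' (fun h => hne (by rw [h]))
        (by simpa [Global.at] using hp) (by simpa [Global.at] using hp')
      obtain ⟨i, hi⟩ := hg c hc
      obtain ⟨j, hj⟩ := hg c' hc'
      refine ⟨i, j, ?_, by rw [pullState_at_of_eq_some hi]; simp [Global.at, hcr],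
        by rw [pullState_at_of_eq_some hj]; simp [Global.at, hcr']⟩
      rintro rfl
      exact hcc (by simpa [hi] using hj)

/-- The set `K` of processes represents the states of the set `D` of processes, those with several
occupants twice. -/
structure Represents (A : ProcessTemplate QA QB QA IA) (B : ProcessTemplate QA QB QB IB)
    (s : Global QA QB n) (D : Set (Proc n)) (s₀ : Global QA QB N) (K : Set (Proc N)) : Prop where
  mem : ∀ p ∈ K, s₀.at p ∈ s.at '' D
  one : ∀ u ∈ s.at '' D, ¬ IsInitial A B u → ∃ p ∈ K, s₀.at p = u
  two : ∀ u ∈ s.at '' D, ¬ IsInitial A B u → ∀ p p', p ≠ p' → s.at p = u → s.at p' = u →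
    ∃ q ∈ K, ∃ q' ∈ K, q ≠ q' ∧ s₀.at q = u ∧ s₀.at q' = u

/-- A member of `K` copies the state and input of some `d ∈ D`. If it sits in the blocking state
itself, then so does `d`; with its blocker, `d` makes two occupants, so `K` has two as well and one
of them is another process. -/
theorem Represents.blocked (hAB : IsOneConjunctive A B) {s₀ : Global QA QB N} {K : Set (Proc N)}
    (hK : Represents A B s D s₀ K)
    (hD : ∀ d ∈ D, ∀ r u, LocalTrans A B (s.at d) (e.at d) {r}ᶜ u →
      (∃ p ≠ d, s.at p = r) ∧ r ∈ occupied s D R)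
    {e₀ : Global IA IB N} (he : ∀ p ∈ K, ∃ d ∈ D, s.at d = s₀.at p ∧ e.at d = e₀.at p) :
    ∀ p ∈ K, ∀ r u, LocalTrans A B (s₀.at p) (e₀.at p) {r}ᶜ u →
      (∃ p' ∈ K, p' ≠ p ∧ s₀.at p' = r) ∨ ∃ r₀ ∈ R, r = .inr r₀ := by
  intro p hp r u hu
  obtain ⟨r', hr', heq⟩ := hu.guard hAB
  obtain rfl : r = r' := by simpa using heq
  obtain ⟨d, hd, hs, hde⟩ := he p hp
  rw [← hs, ← hde] at hu
  obtain ⟨⟨p', hp', hpr⟩, hocc⟩ := hD d hd r u hu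
  rcases hocc with hrD | ⟨r₀, hr₀, rfl⟩
  · left
    by_cases hrp : s₀.at p = r
    · obtain ⟨q, hq, q', hq', hne, h1, h2⟩ := hK.two r hrD hr' p' d hp' hpr (hs.trans hrp)
      by_cases hqp : q = p
      · exact ⟨q', hq', fun h => hne (hqp.trans h.symm), h2⟩
      · exact ⟨q, hq, hqp, h1⟩
    · obtain ⟨q, hq, h⟩ := hK.one r hrD hr'
      exact ⟨q, hq, fun h' => hrp (h' ▸ h), h⟩
  · exact Or.inr ⟨r₀, hr₀, rfl⟩

/-- Members of `K` take the inputs of the processes they represent; the others take the inputs with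
which their paths home begin. Then `K` stays blocked while the rest runs the lasso, or, if there is
no rest, the configuration is a global deadlock. The last two hypotheses ensure that a process
outside `K` has a moving counterpart to borrow a home cycle from. -/
theorem IsStuckConfig.transfer (hAB : IsOneConjunctive A B) (h : IsStuckConfig A B s e D R)
    {s₀ : Global QA QB N} (hs₀ : Reachable A B s₀) {K : Set (Proc N)}
    (hK : Represents A B s D s₀ K)
    (hmoving : ∀ p ∉ K, s₀.at p = initAt A B p ∨ ∃ r ∈ R, s₀.at p = .inr r)
    (hR : ∀ r ∈ R, ∃ p, s₀.at p = .inr r)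
    (hfresh : R.Nonempty → ∃ p ∉ K, s₀.at p = .inr B.init)
    (hKA : .A ∈ K ∨ .A ∉ D) (hKB : (∀ i, .B i ∈ K) ∨ ∃ b, .B b ∉ D) :
    (K.Nonempty → K ≠ Set.univ → HasFairLocalDeadlock A B N) ∧
      (K = Set.univ → HasGlobalDeadlock A B N) := by
  have hhome : ∀ p ∉ K, Relation.TransGen (StateStep A B (occupied s D R)) (s₀.at p)
      (initAt A B p) := by
    intro p hp
    rcases hmoving p hp with hi | ⟨r, hr, hpr⟩
    · rw [hi]
      cases p with
      | A => exact h.home .A (hKA.resolve_left hp)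
      | B i =>
        obtain ⟨b, hb⟩ := hKB.resolve_left fun h => hp (h i)
        exact h.home _ hb
    · rw [hpr]
      cases p with
      | A => simp [Global.at] at hpr
      | B i => exact h.leave r hr
  have hinput : ∀ p, ∃ v : IA ⊕ IB, v.isLeft = (s₀.at p).isLeft ∧
      (p ∈ K → ∃ d ∈ D, s.at d = s₀.at p ∧ e.at d = v) ∧
      (p ∉ K → ∀ v' : IA ⊕ IB, v'.isLeft = (s₀.at p).isLeft →
        Relation.TransGen (LocalStep A B (occupied s D R)) (s₀.at p, v) (initAt A B p, v')) := by
    intro p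
    by_cases hp : p ∈ K
    · obtain ⟨d, hd, hds⟩ := hK.mem p hp
      exact ⟨e.at d, by rw [← hds]; exact e.isLeft_at s d, fun _ => ⟨d, hd, hds, rfl⟩,
        fun h => absurd hp h⟩
    · obtain ⟨v, hv, hv'⟩ := exists_transGen_localStep (hhome p hp)
      exact ⟨v, hv, fun h => absurd h hp, fun _ => hv'⟩
  obtain ⟨e₀, he₀⟩ := Global.exists_of_forall (n := N) (P := fun p v =>
      (p ∈ K → ∃ d ∈ D, s.at d = s₀.at p ∧ e.at d = v) ∧
      (p ∉ K → ∀ v' : IA ⊕ IB, v'.isLeft = (s₀.at p).isLeft →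
        Relation.TransGen (LocalStep A B (occupied s D R)) (s₀.at p, v) (initAt A B p, v')))
    (by
      obtain ⟨v, hv, hP⟩ := hinput .A
      rcases v with x | y
      · exact ⟨x, hP⟩
      · simp [Global.at] at hv)
    (fun i => by
      obtain ⟨v, hv, hP⟩ := hinput (.B i)
      rcases v with x | y
      · simp [Global.at] at hv
      · exact ⟨y, hP⟩)
  have hblock := hK.blocked hAB h.blocked fun p hp => (he₀ p).1 hp
  refine ⟨fun hne huniv => ?_, ?_⟩
  · refine hasFairLocalDeadlock_of_lasso hAB (F := occupied s D R) hs₀ hne huniv ?_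
      (fun r hr => Or.inr ⟨r, hr, rfl⟩) hblock hmoving ?_ ?_ h.init_notMem hfresh ?_
    · intro p
      by_cases hp : p ∈ K
      · exact Or.inl (Or.inl (hK.mem p hp))
      · rcases hmoving p hp with hi | ⟨r, hr, hpr⟩
        · exact Or.inr ((isInitial_at_iff A B).2 hi)
        · exact Or.inl (Or.inr ⟨r, hr, hpr.symm⟩)
    · intro p hp v hv
      exact (he₀ p).2 hp v (hv.trans (e₀.isLeft_at s₀ p))
    · intro r hr
      obtain ⟨p, hp⟩ := hR r hr
      exact ⟨p, fun hpK => h.disjoint r hr (hp ▸ hK.mem p hpK), hp⟩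
    · intro r hr
      obtain ⟨v, hv, hv'⟩ := exists_transGen_localStep (IA := IA) (IB := IB) (h.enter r hr)
      rcases v with x | σ
      · simp at hv
      · exact ⟨σ, fun σ' => hv' _ rfl⟩
  · rintro rfl
    refine hasGlobalDeadlock_iff.2 ⟨s₀, e₀, hs₀, fun p => ?_⟩
    rw [not_enabled_iff hAB]
    intro r u hu
    rcases hblock p (Set.mem_univ p) r u hu with ⟨p', -, h1, h2⟩ | ⟨r₀, hr₀, rfl⟩
    · exact ⟨p', h1, h2⟩
    · obtain ⟨p, hp, -⟩ := hfresh ⟨r₀, hr₀⟩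
      exact absurd (Set.mem_univ p) hp

/-- If all copies of `B` are stuck, then as many of them can be kept as one likes, as long as each
state with several occupants keeps two of them. -/
theorem IsStuckConfig.hasFairLocalDeadlock_of_forall_mem (hAB : IsOneConjunctive A B)
    (h : IsStuckConfig A B s e D R) (hB : ∀ b, .B b ∈ D) {S : Finset (Fin n)}
    (hS : S.Nonempty) (hcov : ∀ r ≠ B.init, CoversTwice s.2 S r) :
    HasFairLocalDeadlock A B S.card := by
  have hA : .A ∉ D := fun hA => h.ne_univ (Set.eq_univ_of_forall fun p => by
    cases p with
    | A => exact hA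
    | B b => exact hB b)
  have hR : ∀ r, r ∉ R := fun r hr => by
    obtain ⟨b, hb⟩ := h.exists_at r hr
    exact h.disjoint r hr ⟨.B b, hB b, by simp [Global.at, hb]⟩
  obtain ⟨g, hinj, hgS, hSg, hnone⟩ := exists_enumeration S le_rfl
  have hsome : ∀ i, ∃ b, g i = some b := fun i =>
    Option.ne_none_iff_exists'.1 fun hi => i.2.not_ge ((hnone i).1 hi)
  obtain ⟨b₀, hb₀⟩ := hS
  have hinl : ∀ u ∈ s.at '' D, ∃ r, u = .inr r := by
    rintro _ ⟨d, hd, rfl⟩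
    cases d with
    | A => exact absurd hd hA
    | B b => exact ⟨_, rfl⟩
  refine (h.transfer hAB (h.reachable.pullState hAB hinj (e.1, fun _ => e.2 b₀))
    (K := {p | p ≠ .A}) ⟨?_, ?_, ?_⟩ ?_ ?_ ?_ (Or.inr hA) (Or.inl fun i => by simp)).1 ?_ ?_
  · intro p hp
    cases p with
    | A => exact absurd rfl hp
    | B i =>
      obtain ⟨b, hb⟩ := hsome i
      exact ⟨.B b, hB b, (pullState_at_of_eq_some hb).symm⟩
  · intro u hu hi
    obtain ⟨r, rfl⟩ := hinl u hu
    obtain ⟨d, -, hd⟩ := hu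
    obtain ⟨i, h'⟩ := exists_pullState_at (B := B) hSg (hcov r hi) hd
    exact ⟨.B i, by simp, h'⟩
  · intro u hu hi p p' hne hp hp'
    obtain ⟨r, rfl⟩ := hinl u hu
    obtain ⟨i, j, hij, h1, h2⟩ := exists_two_pullState_at (B := B) hSg (hcov r hi) hne hp hp'
    exact ⟨.B i, by simp, .B j, by simp, by simpa using hij, h1, h2⟩
  · intro p hp
    obtain rfl : p = .A := by simpa using hp
    left
    simp [pullState, Global.at, initAt, h.fst_eq hA]
  · exact fun r hr => absurd hr (hR r)
  · exact fun ⟨r, hr⟩ => absurd hr (hR r)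
  · obtain ⟨i, -⟩ := hSg b₀ hb₀
    exact ⟨.B i, by simp⟩
  · intro huniv
    have : Proc.A ∈ {p : Proc S.card | p ≠ .A} := huniv ▸ Set.mem_univ _
    exact this rfl

/-- If some copy of `B` keeps moving, then all copies but the selected ones can be replaced by
copies that start from the initial state. -/
theorem IsStuckConfig.hasDeadlock_of_notMem (hAB : IsOneConjunctive A B)
    (h : IsStuckConfig A B s e D R) {b₀ : Fin n} (hb₀ : .B b₀ ∉ D) {S : Finset (Fin n)}
    (hS : ∀ b ∈ S, s.2 b ≠ B.init ∧ (Sum.inr (s.2 b) ∈ s.at '' D ∨ s.2 b ∈ R))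
    (hcov : ∀ r ≠ B.init, Sum.inr r ∈ s.at '' D → CoversTwice s.2 S r)
    (hSR : ∀ r ∈ R, ∃ b ∈ S, s.2 b = r)
    (hN : S.card ≤ N) (hRN : R.Nonempty → S.card < N)
    (htwo : .A ∉ D → (∀ r, Sum.inr r ∈ s.at '' D → r = B.init) → S.card + 2 ≤ N) :
    HasFairLocalDeadlock A B N ∨ (S.card = N ∧ HasGlobalDeadlock A B N) := by
  obtain ⟨g, hinj, hgS, hSg, hnone⟩ := exists_enumeration S hN
  have hreach := h.reachable.pullState hAB hinj (e.1, fun _ => e.2 b₀)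
  have hRat : ∀ r ∈ R, ∃ p, (pullState B g s).at p = .inr r := by
    intro r hr
    obtain ⟨b, hb, hbr⟩ := hSR r hr
    obtain ⟨i, hi⟩ := hSg b hb
    exact ⟨.B i, by rw [pullState_at_of_eq_some hi]; simp [Global.at, hbr]⟩
  have hAt : (pullState B g s).at .A = s.at .A := rfl
  have hinl : ∀ a, Sum.inl a ∈ s.at '' D → .A ∈ D ∧ s.at .A = .inl a := by
    rintro a ⟨d, hd, ha⟩
    cases d with
    | A => exact ⟨hd, ha⟩
    | B b => simp [Global.at] at ha
  have hAinit : .A ∉ D → (pullState B g s).at .A = initAt A B (.A : Proc N) := fun hA => by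
    simp [pullState, Global.at, initAt, h.fst_eq hA]
  -- If the only stuck state is the initial state of `B`, no selected copy is stuck. A fresh copy
  -- `i₁` then plays the stuck process, blocked through `R`, and a second one `i₂` serves for the
  -- exchanges.
  by_cases hcase : .A ∉ D ∧ ∀ r, Sum.inr r ∈ s.at '' D → r = B.init
  · left
    obtain ⟨hA, hU⟩ := hcase
    have hcard := htwo hA hU
    have hinit : ∀ u ∈ s.at '' D, u = .inr B.init := by
      intro u hu
      rcases u with a | r
      · exact absurd (hinl a hu).1 hA
      · rw [hU r hu]
    let i₁ : Fin N := ⟨S.card, by omega⟩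
    let i₂ : Fin N := ⟨S.card + 1, by omega⟩
    have hi₁ : g i₁ = none := (hnone i₁).2 le_rfl
    have hi₂ : g i₂ = none := (hnone i₂).2 (Nat.le_succ _)
    have h12 : i₂ ≠ i₁ := by simp [i₁, i₂]
    refine (h.transfer hAB hreach (K := {.B i₁}) ⟨?_, ?_, ?_⟩ ?_ hRat ?_ (Or.inr hA)
      (Or.inr ⟨b₀, hb₀⟩)).1 (Set.singleton_nonempty _) ?_
    · rintro p rfl
      rw [pullState_at_of_eq_none hi₁]
      obtain ⟨d, hd⟩ := h.nonempty
      exact ⟨d, hd, hinit _ ⟨d, hd, rfl⟩⟩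
    · exact fun u hu hi => absurd (by rw [hinit u hu]; rfl) hi
    · exact fun u hu hi => absurd (by rw [hinit u hu]; rfl) hi
    · intro p _
      cases p with
      | A => exact Or.inl (hAinit hA)
      | B i =>
        rcases hi : g i with _ | b
        · exact Or.inl (pullState_at_of_eq_none hi)
        · right
          rw [pullState_at_of_eq_some hi]
          obtain ⟨h1, h2⟩ := hS b (hgS i b hi)
          exact ⟨s.2 b, h2.resolve_left fun h' => h1 (hU _ h'), rfl⟩
    · exact fun _ => ⟨.B i₂, by simpa using h12, pullState_at_of_eq_none hi₂⟩
    · intro huniv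
      have : Proc.A ∈ ({.B i₁} : Set (Proc N)) := huniv ▸ Set.mem_univ _
      simp at this
  · have hcase' : .A ∈ D ∨ ∃ r ≠ B.init, Sum.inr r ∈ s.at '' D := by
      by_contra! hc
      exact hcase ⟨hc.1, fun r hr => by_contra fun h' => hc.2 r h' hr⟩
    -- Copies in the initial state are left out of `K`: they block nobody, and they remain available
    -- for the exchanges.
    have hrep : Represents A B s D (pullState B g s)
        {p | (pullState B g s).at p ∈ s.at '' D ∧ (pullState B g s).at p ≠ .inr B.init} := by
      refine ⟨fun p hp => hp.1, fun u hu hi => ?_, fun u hu hi p p' hne hp hp' => ?_⟩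
      · rcases u with a | r
        · have ha := (hinl a hu).2
          exact ⟨.A, ⟨by rw [hAt, ha]; exact hu, by rw [hAt, ha]; simp⟩, ha⟩
        · obtain ⟨d, -, hd⟩ := id hu
          obtain ⟨i, hir⟩ := exists_pullState_at (B := B) hSg (hcov r hi hu) hd
          exact ⟨.B i, ⟨by rw [hir]; exact hu, by rw [hir]; exact fun h' => hi (Sum.inr.inj h')⟩,
            hir⟩
      · rcases u with a | r
        · cases p <;> cases p' <;> simp [Global.at] at hp hp' hne
        · obtain ⟨i, j, hij, h1, h2⟩ :=
            exists_two_pullState_at (B := B) hSg (hcov r hi hu) hne hp hp'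
          have hri : (Sum.inr r : QA ⊕ QB) ≠ .inr B.init := fun h' => hi (Sum.inr.inj h')
          exact ⟨.B i, ⟨by rw [h1]; exact hu, by rw [h1]; exact hri⟩,
            .B j, ⟨by rw [h2]; exact hu, by rw [h2]; exact hri⟩, by simpa using hij, h1, h2⟩
    have hfreshK : ∀ i, g i = none → Proc.B i ∉ {p | (pullState B g s).at p ∈ s.at '' D ∧
        (pullState B g s).at p ≠ .inr B.init} :=
      fun i hi hK => hK.2 (pullState_at_of_eq_none hi)
    have hfresh : S.card < N → ∃ p ∉ {p | (pullState B g s).at p ∈ s.at '' D ∧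
        (pullState B g s).at p ≠ .inr B.init}, (pullState B g s).at p = .inr B.init :=
      fun hlt => ⟨.B ⟨S.card, hlt⟩, hfreshK _ ((hnone _).2 le_rfl),
        pullState_at_of_eq_none ((hnone _).2 le_rfl)⟩
    have hAK : .A ∈ D → Proc.A ∈ {p | (pullState B g s).at p ∈ s.at '' D ∧
        (pullState B g s).at p ≠ .inr B.init} := fun hA =>
      ⟨⟨.A, hA, rfl⟩, by simp [Global.at]⟩
    have hne : {p | (pullState B g s).at p ∈ s.at '' D ∧
        (pullState B g s).at p ≠ .inr B.init}.Nonempty := by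
      rcases hcase' with hA | ⟨r, hr, hrD⟩
      · exact ⟨_, hAK hA⟩
      · obtain ⟨p, hp, -⟩ := hrep.one (.inr r) hrD hr
        exact ⟨p, hp⟩
    have key := h.transfer hAB hreach hrep (fun p hp => by
      cases p with
      | A => exact Or.inl (hAinit fun hA => hp (hAK hA))
      | B i =>
        rcases hi : g i with _ | b
        · exact Or.inl (pullState_at_of_eq_none hi)
        · right
          obtain ⟨h1, h2⟩ := hS b (hgS i b hi)
          have hat : (pullState B g s).at (.B i) = .inr (s.2 b) := pullState_at_of_eq_some hi
          refine ⟨s.2 b, h2.resolve_left fun h' => hp ⟨?_, ?_⟩, hat⟩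
          · rw [hat]; exact h'
          · rw [hat]; exact fun h' => h1 (Sum.inr.inj h'))
      hRat (fun hR => hfresh (hRN hR)) (by
        by_cases hA : .A ∈ D
        · exact Or.inl (hAK hA)
        · exact Or.inr hA) (Or.inr ⟨b₀, hb₀⟩)
    by_cases huniv : {p | (pullState B g s).at p ∈ s.at '' D ∧
        (pullState B g s).at p ≠ .inr B.init} = Set.univ
    -- An unused place would hold a fresh copy outside `K`.
    · refine Or.inr ⟨hN.antisymm (not_lt.1 fun hlt => ?_), key.2 huniv⟩
      obtain ⟨p, hp, -⟩ := hfresh hlt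
      exact hp (huniv ▸ Set.mem_univ p)
    · exact Or.inl (key.1 hne huniv)

/-- A set of processes that block each other yields a deadlock in the system with one more copy. -/
theorem hasFairDeadlock_succ_of_blocked (hAB : IsOneConjunctive A B) (hn : 1 ≤ n)
    (hinit : FairRunsInitializing A B (n + 1)) (hs : Reachable A B s) (hD : D.Nonempty)
    (hblock : ∀ p ∈ D, ∀ r u, LocalTrans A B (s.at p) (e.at p) {r}ᶜ u →
      ∃ p' ∈ D, p' ≠ p ∧ s.at p' = r) :
    HasFairDeadlock A B (n + 1) := by
  let g : Fin (n + 1) → Option (Fin n) := fun i => if h : i.1 < n then some ⟨i, h⟩ else none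
  -- The new copy borrows the input of copy `0`, which exists since `1 ≤ n`.
  let e₀ : Global IA IB (n + 1) := (e.1, fun i => if h : i.1 < n then e.2 ⟨i, h⟩ else e.2 ⟨0, hn⟩)
  let ι : Proc n → Proc (n + 1) := fun p => match p with
    | .A => .A
    | .B i => .B i.castSucc
  have hι : ∀ p p', ι p = ι p' → p = p' := by
    intro p p' h
    cases p <;> cases p' <;> simp_all [ι]
  have hsι : ∀ p, (pullState B g s).at (ι p) = s.at p := by
    intro p
    cases p with
    | A => rfl
    | B i => exact pullState_at_of_eq_some (by simp [g])
  have heι : ∀ p, e₀.at (ι p) = e.at p := by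
    intro p
    cases p <;> simp [ι, e₀, Global.at]
  refine hasFairDeadlock_of_blocked hAB hinit (e := e₀)
    (hs.pullState hAB (g := g) (fun i j b hi hj => ?_) e₀) (hD.image ι) ?_
  · simp only [g, Option.dite_none_right_eq_some, Option.some.injEq] at hi hj
    obtain ⟨hi, rfl⟩ := hi
    obtain ⟨hj, h⟩ := hj
    exact Fin.ext (by simpa using h.symm)
  · rintro _ ⟨p, hp, rfl⟩ r u hu
    rw [hsι, heι] at hu
    obtain ⟨p', hp', hne, hr⟩ := hblock p hp r u hu
    exact ⟨ι p', ⟨p', hp', rfl⟩, fun h => hne (hι _ _ h), by rw [hsι, hr]⟩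

end Transfer

/-! ### Counting: bounds and monotonicity -/

section Bounds

variable {QA QB IA IB : Type*} {A : ProcessTemplate QA QB QA IA} {B : ProcessTemplate QA QB QB IB}
  {n N : ℕ} {s : Global QA QB n} {e : Global IA IB n} {D : Set (Proc n)} {R : Set QB}

open Classical in
theorem sum_ite_eq_mul_ncard_compl {α : Type*} [Fintype α] (a₀ : α) (c : ℕ) :
    ∑ a : α, (if a = a₀ then 0 else c) = c * ({a₀}ᶜ : Set α).ncard := by
  rw [Finset.sum_ite, Finset.sum_const_zero, zero_add, Finset.sum_const, smul_eq_mul, mul_comm,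
    Set.ncard_eq_toFinset_card']
  congr 2
  ext a
  simp

theorem exists_coversTwice [Finite QB] (q : QB) (f : Fin n → QB)
    (hN : 2 * ({q}ᶜ : Set QB).ncard ≤ N) (hn : N ≤ n) :
    ∃ S : Finset (Fin n), S.card = N ∧ ∀ r ≠ q, CoversTwice f S r := by
  classical
  cases nonempty_fintype QB
  obtain ⟨S, hS, -, -, hcov⟩ := exists_selection f fun r => if r = q then 0 else 2
  rw [sum_ite_eq_mul_ncard_compl] at hS
  obtain ⟨T, hST, hT⟩ := Finset.exists_superset_card_eq (hS.trans hN) (by simpa using hn)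
  exact ⟨T, hT, fun r hr => (hcov r (by simp [hr])).mono hST⟩

/-- This is the blocking argument with all processes stuck and `R = ∅`. -/
theorem HasGlobalDeadlock.of_coversTwice (hAB : IsOneConjunctive A B) (hn : 0 < n)
    (hs : Reachable A B s) (hdis : ∀ p, ¬ Enabled A B s e p) {S : Finset (Fin n)}
    (hcov : ∀ r ≠ B.init, CoversTwice s.2 S r) : HasGlobalDeadlock A B S.card := by
  obtain ⟨g, hinj, hgS, hSg, hnone⟩ := exists_enumeration S le_rfl
  have hsome : ∀ i, ∃ b, g i = some b := fun i =>
    Option.ne_none_iff_exists'.1 fun hi => i.2.not_ge ((hnone i).1 hi)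
  let e₀ : Global IA IB S.card := (e.1, fun i => (g i).elim (e.2 ⟨0, hn⟩) e.2)
  have hat : ∀ p : Proc S.card, ∃ p', s.at p' = (pullState B g s).at p ∧ e.at p' = e₀.at p := by
    intro p
    cases p with
    | A => exact ⟨.A, rfl, rfl⟩
    | B i =>
      obtain ⟨b, hb⟩ := hsome i
      exact ⟨.B b, (pullState_at_of_eq_some hb).symm, by simp [e₀, Global.at, hb]⟩
  have hrep : Represents A B s Set.univ (pullState B g s) Set.univ := by
    refine ⟨fun p _ => ?_, ?_, ?_⟩
    · obtain ⟨p', hp', -⟩ := hat p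
      exact ⟨p', Set.mem_univ _, hp'⟩
    · rintro u ⟨p, -, hp⟩ hi
      rcases u with a | r
      · cases p with
        | A => exact ⟨.A, Set.mem_univ _, hp⟩
        | B b => simp [Global.at] at hp
      · obtain ⟨i, h⟩ := exists_pullState_at (B := B) hSg (hcov r hi) hp
        exact ⟨.B i, Set.mem_univ _, h⟩
    · rintro u - hi p p' hne hp hp'
      rcases u with a | r
      · cases p <;> cases p' <;> simp [Global.at] at hp hp' hne
      · obtain ⟨i, j, hij, h1, h2⟩ := exists_two_pullState_at (B := B) hSg (hcov r hi) hne hp hp'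
        exact ⟨.B i, Set.mem_univ _, .B j, Set.mem_univ _, by simpa using hij, h1, h2⟩
  have hblock := hrep.blocked (R := ∅) (e := e) (e₀ := e₀) hAB (fun d _ r u hu => by
      obtain ⟨p, hp, hpr⟩ := (not_enabled_iff hAB).1 (hdis d) r u hu
      exact ⟨⟨p, hp, hpr⟩, Or.inl ⟨p, Set.mem_univ _, hpr⟩⟩)
    fun p _ => (hat p).imp fun _ h => ⟨Set.mem_univ _, h⟩
  refine hasGlobalDeadlock_iff.2 ⟨_, e₀, hs.pullState hAB hinj e₀, fun p => ?_⟩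
  rw [not_enabled_iff hAB]
  intro r u hu
  rcases hblock p (Set.mem_univ p) r u hu with ⟨p', -, h1, h2⟩ | ⟨_, h, -⟩
  · exact ⟨p', h1, h2⟩
  · exact absurd h (Set.notMem_empty _)

theorem HasGlobalDeadlock.bound [Finite QB] (hAB : IsOneConjunctive A B)
    (hN : 2 * ({B.init}ᶜ : Set QB).ncard ≤ N) (hn : N < n) (h : HasGlobalDeadlock A B n) :
    HasGlobalDeadlock A B N := by
  obtain ⟨s, e, hs, hdis⟩ := hasGlobalDeadlock_iff.1 h
  obtain ⟨S, rfl, hS⟩ := exists_coversTwice B.init s.2 hN hn.le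
  exact .of_coversTwice hAB (by omega) hs hdis hS

/-- Non-initial stuck states get weight 2 and states of `R` weight 1. A nonempty `R` thus saves a
place for the fresh copy, and without non-initial stuck states of `B` all weights are at most 1. -/
theorem IsStuckConfig.exists_selection [Finite QB] (h : IsStuckConfig A B s e D R) :
    ∃ S : Finset (Fin n),
      (∀ b ∈ S, s.2 b ≠ B.init ∧ (Sum.inr (s.2 b) ∈ s.at '' D ∨ s.2 b ∈ R)) ∧
      (∀ r ≠ B.init, Sum.inr r ∈ s.at '' D → CoversTwice s.2 S r) ∧
      (∀ r ∈ R, ∃ b ∈ S, s.2 b = r) ∧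
      S.card ≤ 2 * ({B.init}ᶜ : Set QB).ncard ∧
      (R.Nonempty → S.card < 2 * ({B.init}ᶜ : Set QB).ncard) ∧
      ((∀ r, Sum.inr r ∈ s.at '' D → r = B.init) → S.card ≤ ({B.init}ᶜ : Set QB).ncard) := by
  classical
  cases nonempty_fintype QB
  let w : QB → ℕ := fun r =>
    if r = B.init then 0 else if Sum.inr r ∈ s.at '' D then 2 else if r ∈ R then 1 else 0
  have hw2 : ∀ r, w r ≤ if r = B.init then 0 else 2 := by
    intro r
    simp only [w]
    split_ifs <;> omega
  have hRinit : ∀ r ∈ R, r ≠ B.init := fun r hr h' => h.init_notMem (h' ▸ hr)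
  have hwR : ∀ r ∈ R, w r = 1 := fun r hr => by
    simp only [w, if_neg (hRinit r hr), if_neg (h.disjoint r hr), if_pos hr]
  obtain ⟨S, hS, hne, hone, htwo⟩ := GuardedProtocol.exists_selection s.2 w
  refine ⟨S, fun b hb => ?_, fun r hr hrD => htwo r ?_, fun r hr => ?_, ?_, fun hR => ?_,
    fun hU => ?_⟩
  · have := hne b hb
    simp only [w] at this
    split_ifs at this with h1 h2 h3
    · exact absurd rfl this
    · exact ⟨h1, Or.inl h2⟩
    · exact ⟨h1, Or.inr h3⟩
    · exact absurd rfl this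
  · simp only [w, if_neg hr, if_pos hrD, le_refl]
  · obtain ⟨b, rfl⟩ := h.exists_at r hr
    exact hone b (hwR _ hr).ge
  · rw [← sum_ite_eq_mul_ncard_compl]
    exact hS.trans (Finset.sum_le_sum fun r _ => hw2 r)
  · rw [← sum_ite_eq_mul_ncard_compl]
    obtain ⟨r, hr⟩ := hR
    refine hS.trans_lt (Finset.sum_lt_sum (fun r _ => hw2 r) ⟨r, Finset.mem_univ r, ?_⟩)
    rw [hwR r hr, if_neg (hRinit r hr)]
    exact Nat.one_lt_two
  · rw [← one_mul (Set.ncard _), ← sum_ite_eq_mul_ncard_compl]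
    refine hS.trans (Finset.sum_le_sum fun r _ => ?_)
    simp only [w]
    split_ifs with h1 h2
    · exact le_rfl
    · exact absurd (hU r h2) h1
    · exact le_rfl
    · exact Nat.zero_le _

/-- A local deadlock in a large system yields one in each smaller system that is not too small,
or, in the smallest of them, a global deadlock. -/
theorem HasFairLocalDeadlock.bound [Finite QB] (hAB : IsOneConjunctive A B)
    (hm : 2 ≤ ({B.init}ᶜ : Set QB).ncard) (hN : 2 * ({B.init}ᶜ : Set QB).ncard ≤ N) (hn : N < n)
    (h : HasFairLocalDeadlock A B n) :
    HasFairLocalDeadlock A B N ∨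
      (N = 2 * ({B.init}ᶜ : Set QB).ncard ∧ HasGlobalDeadlock A B N) := by
  obtain ⟨s, e, D, R, h⟩ := h.exists_isStuckConfig hAB
  by_cases hB : ∀ b, .B b ∈ D
  · obtain ⟨S, rfl, hS⟩ := exists_coversTwice B.init s.2 hN hn.le
    exact Or.inl (h.hasFairLocalDeadlock_of_forall_mem hAB hB
      (Finset.card_pos.1 (by omega)) hS)
  · push Not at hB
    obtain ⟨b₀, hb₀⟩ := hB
    obtain ⟨S, hS, hcov, hSR, h1, h2, h3⟩ := h.exists_selection
    refine (h.hasDeadlock_of_notMem hAB hb₀ hS hcov hSR (h1.trans hN)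
      (fun hR => (h2 hR).trans_le hN) fun _ hU => ?_).imp_right fun hg => ⟨?_, hg.2⟩
    · have := h3 hU
      omega
    · have := hg.1
      omega

theorem HasFairDeadlock.bound [Finite QB] (hAB : IsOneConjunctive A B)
    (hm : 2 ≤ ({B.init}ᶜ : Set QB).ncard) (hn : 2 * ({B.init}ᶜ : Set QB).ncard < n)
    (h : HasFairDeadlock A B n) :
    HasFairDeadlock A B (2 * ({B.init}ᶜ : Set QB).ncard) := by
  rcases h with h | h
  · exact Or.inl (h.bound hAB le_rfl hn)
  · rcases h.bound hAB hm le_rfl hn with h | ⟨-, h⟩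
    · exact Or.inr h
    · exact Or.inl h

theorem HasFairDeadlock.succ [Finite QB] (hAB : IsOneConjunctive A B) (hn : 1 ≤ n)
    (hinit : FairRunsInitializing A B (n + 1)) (h : HasFairDeadlock A B n) :
    HasFairDeadlock A B (n + 1) := by
  rcases h with h | h
  · obtain ⟨s, e, hs, hdis⟩ := hasGlobalDeadlock_iff.1 h
    refine hasFairDeadlock_succ_of_blocked hAB hn hinit hs (D := Set.univ) (e := e)
      ⟨.A, Set.mem_univ _⟩ fun p _ r u hu => ?_
    obtain ⟨p', h1, h2⟩ := (not_enabled_iff hAB).1 (hdis p) r u hu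
    exact ⟨p', Set.mem_univ _, h1, h2⟩
  · obtain ⟨s, e, D, R, h⟩ := h.exists_isStuckConfig hAB
    by_cases hB : ∀ b, .B b ∈ D
    -- With every copy of `B` stuck, no home cycle is known for the new copy. It is scheduled freely
    -- instead, and `hinit` makes the resulting run initializing.
    · refine hasFairDeadlock_succ_of_blocked hAB hn hinit h.reachable h.nonempty (e := e)
        fun p hp r u hu => ?_
      obtain ⟨⟨p', h1, h2⟩, hocc⟩ := h.blocked p hp r u hu
      refine ⟨p', ?_, h1, h2⟩
      cases p' with
      | B b => exact hB b
      | A =>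
        rcases hocc with ⟨d, hd, hdr⟩ | ⟨r₀, hr₀, rfl⟩
        · cases d with
          | A => exact hd
          | B b =>
            rw [← h2] at hdr
            simp [Global.at] at hdr
        · simp [Global.at] at h2
    · push Not at hB
      obtain ⟨b₀, hb₀⟩ := hB
      obtain ⟨S, hS, hcov, hSR, -, -, -⟩ := h.exists_selection
      have hcard : S.card ≤ n := by simpa using S.card_le_univ
      refine (h.hasDeadlock_of_notMem hAB hb₀ hS hcov hSR (hcard.trans (Nat.le_succ n))
        (fun _ => Nat.lt_succ_of_le hcard) fun hA hU => ?_).elim Or.inr fun hg => Or.inl hg.2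
      obtain ⟨d, hd⟩ := h.nonempty
      cases d with
      | A => exact absurd hd hA
      | B b =>
        -- The stuck copy `b` is in the initial state and hence not selected, so `S.card + 2 ≤ n +
        -- 1`.
        have hbS : b ∉ S := fun hb => (hS b hb).1 (hU _ ⟨_, hd, rfl⟩)
        have := Finset.card_lt_univ_of_notMem hbS
        rw [Fintype.card_fin] at this
        omega

end Bounds

end GuardedProtocol

/-! ### The main theorem -/

theorem mainTheorem5 {QA QB IA IB : Type*} [Finite QA] [Finite QB] [Finite IA] [Finite IB]
    (A : GuardedProtocol.ProcessTemplate QA QB QA IA)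
    (B : GuardedProtocol.ProcessTemplate QA QB QB IB)
    (hAB : GuardedProtocol.IsOneConjunctive A B) :
    -- bounding, global deadlocks
    (∀ n : ℕ, 2 * ({B.init}ᶜ : Set QB).ncard < n →
      GuardedProtocol.HasGlobalDeadlock A B n →
      GuardedProtocol.HasGlobalDeadlock A B (2 * ({B.init}ᶜ : Set QB).ncard)) ∧
    -- bounding, local deadlocks
    (2 < Nat.card QB → ∀ n : ℕ, 2 * ({B.init}ᶜ : Set QB).ncard + 1 < n →
      GuardedProtocol.HasFairLocalDeadlock A B n →
      GuardedProtocol.HasFairLocalDeadlock A B (2 * ({B.init}ᶜ : Set QB).ncard + 1)) ∧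
    -- bounding, deadlocks
    (2 < Nat.card QB → ∀ n : ℕ, 2 * ({B.init}ᶜ : Set QB).ncard < n →
      GuardedProtocol.HasFairDeadlock A B n →
      GuardedProtocol.HasFairDeadlock A B (2 * ({B.init}ᶜ : Set QB).ncard)) ∧
    -- monotonicity
    (∀ n : ℕ, 1 ≤ n → GuardedProtocol.FairRunsInitializing A B (n + 1) →
      GuardedProtocol.HasFairDeadlock A B n → GuardedProtocol.HasFairDeadlock A B (n + 1)) ∧
    -- cutoff
    (2 < Nat.card QB → (∀ n : ℕ, 1 ≤ n → GuardedProtocol.FairRunsInitializing A B n) →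
      GuardedProtocol.IsFairDeadlockCutoff A B (2 * Nat.card QB - 2)) := by

  have hcard : ({B.init}ᶜ : Set QB).ncard + 1 = Nat.card QB := by
    rw [← Set.ncard_add_ncard_compl {B.init}, Set.ncard_singleton, add_comm]
  refine ⟨fun n hn h => h.bound hAB le_rfl hn, fun hQ n hn h => ?_,
    fun hQ n hn h => h.bound hAB (by omega) hn, fun n hn hinit h => h.succ hAB hn hinit,
    fun hQ hinit => ?_⟩
  -- The global alternative arises only for exactly `2m` copies, which `2m + 1` excludes.
  · refine (h.bound hAB (by omega) (Nat.le_succ _) hn).resolve_right fun hg => ?_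
    have := hg.1
    omega
  · have hc : 2 * Nat.card QB - 2 = 2 * ({B.init}ᶜ : Set QB).ncard := by omega
    rw [hc]
    intro n hn
    constructor
    · intro h
      rcases hn.eq_or_lt with h' | h'
      · rwa [← h'] at h
      · exact h.bound hAB (by omega) h'
    · intro h
      induction n, hn using Nat.le_induction with
      | base => exact h
      | succ n hn ih => exact ih.succ hAB (by omega) (hinit _ (by omega))
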